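/- Let $n\ge 1$ be an integer. In each part, the infimum is over all measurable real-valued functions of the data, and the pilot estimates and the radii are fixed. (i) Quadratic functional in the Gaussian sequence model. For $\theta\in\ell^2$ let $y=(y_j)_{j\ge1}$ have independent coordinates $y_j\sim N(\theta_j,1/n)$, and let $Q(\theta)=\sum_j\theta_j^2$. There is a universal constant $c>0$ such that for every $n\ge1$, every $\widehat\theta\in\ell^2$ and every $r_n\ge 0$, $$\inf_{\widehat Q}\ \sup_{\theta\in\ell^2:\ \|\theta-\widehat\theta\|_2^2\le r_n}\mathbb E_\theta\big(\widehat Q(y)-Q(\theta)\big)^2\ \ge\ c\Big(r_n^2+\|\widehat\theta\|_2^2\,\min\{r_n,1/n\}\Big).$$ (ii) Integral of the squared density. For every $M>0$ and $R>0$ there is a constant $c>0$, depending only on $M$ and $R$, such that for every $d\ge1$, every $n\ge1$, every probability density $\widehat f$ on $\mathbb R^d$ with $\|\widehat f\|_\infty\le M$ and every $0\le r_n\le R$, $$\inf_{\widehat T}\ \sup_{f}\ \mathbb E_f\Big(\widehat T(X_1,\dots,X_n)-\int f^2\Big)^2\ \ge\ c\Big(r_n^2+\Big[\int\widehat f^3-\Big(\int\widehat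 f^2\Big)^2\Big]\min\{r_n,1/n\}\Big),$$ where the supremum is over all probability densities $f$ on $\mathbb R^d$ with $\|f\|_\infty\le M$ and $\int(f-\widehat f)^2\le r_n$, and $X_1,\dots,X_n$ are i.i.d. with density $f$ under $\mathbb E_f$. (iii) Expected conditional covariance. Let $(X,A,Y)$ take values in $[0,1]^d\times\{0,1\}\times\{0,1\}$ with $X$ uniform on $[0,1]^d$. Its law is described by the measurable functions $\mu(x)=\mathbb E[Y|X=x]$, $\pi(x)=\mathbb E[A|X=x]$ and $\eta(x)=\mathbb E[Y|X=x,A=1]-\mathbb E[Y|X=x,A=0]$. Let $\psi=\mathbb E[\mathrm{cov}(A,Y|X)]=\mathbb E[AY]-\int_{[0,1]^d}\pi\mu\,dx$. For every $\varepsilon>0$ and $R>0$ there is a constant $c>0$, depending only on $\varepsilon$ and $R$, such that for every $d\ge1$, every $n\ge1$, all measurable $\widehat\mu,\widehat\pi$ with values in $[\varepsilon,1-\varepsilon]$ on $[0,1]^d$, and all $0\le r_n,s_n\le R$, $$\inf_{\widehat\psi}\ \sup_{(\mu,\pi,\eta)}\mathbb E\Big(\widehat\psi\big((X_i,A_i,Y_i)_{i\le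 n}\big)-\psi\Big)^2\ \ge\ c\Big(r_n s_n+\frac1n\Big),$$ where the supremum is over all such laws with $\int_{[0,1]^d}(\mu-\widehat\mu)^2dx\le r_n$ and $\int_{[0,1]^d}(\pi-\widehat\pi)^2dx\le s_n$, and the $n$ observations are i.i.d. -/

import Mathlib

open MeasureTheory ProbabilityTheory
open scoped ENNReal NNReal

noncomputable section

namespace StructureAgnostic

/-! ### Minimax squared-error risk -/

/-- The minimax squared-error risk `inf_T̂ sup_{θ ∈ Θ} E_θ (T̂ - T θ)²` for estimating the functional
`T` over the parameter set `Θ`, when the data have law `law θ`. The infimum runs over all measurable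
real-valued functions of the data. Risks take values in `[0, ∞]`. -/
def minimaxRisk {P D : Type*} [MeasurableSpace D] (Θ : Set P) (law : P → Measure D) (T : P → ℝ) :
    ℝ≥0∞ :=
  ⨅ (est : D → ℝ) (_ : Measurable est),
    ⨆ θ ∈ Θ, ∫⁻ x, ENNReal.ofReal ((est x - T θ) ^ 2) ∂(law θ)

/-! ### Gaussian sequence model -/

/-- The space `ℓ²` of square-summable real sequences. -/
abbrev SeqSpace : Type := lp (fun _ : ℕ => ℝ) 2

/-- The law of `y = (y_j)`, with `y_j ~ N(θ_j, 1/n)` independent. -/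
def seqLaw (n : ℕ) (θ : SeqSpace) : Measure (ℕ → ℝ) :=
  Measure.infinitePi fun j => gaussianReal (θ j) (n : ℝ≥0)⁻¹

/-- The quadratic functional `Q(θ) = ∑ θ_j²`. -/
def seqQuad (θ : SeqSpace) : ℝ := ∑' j, θ j ^ 2

/-- The set of parameters `θ` with `‖θ - θhat‖₂² ≤ r`. -/
def seqClass (θhat : SeqSpace) (r : ℝ) : Set SeqSpace := {θ | ‖θ - θhat‖ ^ 2 ≤ r}

/-- Minimax risk for the quadratic functional in the Gaussian sequence model. -/
def seqMinimaxRisk (n : ℕ) (θhat : SeqSpace) (r : ℝ) : ℝ≥0∞ :=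
  minimaxRisk (seqClass θhat r) (seqLaw n) seqQuad

/-! ### Density model on `ℝ^d` -/

/-- `f` is a probability density on `ℝ^d` (with respect to Lebesgue measure), essentially bounded
by `M`. -/
structure IsBoundedDensity {d : ℕ} (M : ℝ) (f : (Fin d → ℝ) → ℝ) : Prop where
  measurable : Measurable f
  nonneg : ∀ x, 0 ≤ f x
  integral_eq_one : ∫ x, f x = 1
  le_bound : ∀ᵐ x, f x ≤ M

/-- The law of an i.i.d. sample of size `n` from the density `f`. -/
def densLaw {d : ℕ} (n : ℕ) (f : (Fin d → ℝ) → ℝ) : Measure (Fin n → Fin d → ℝ) :=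
  Measure.pi fun _ => volume.withDensity fun x => ENNReal.ofReal (f x)

/-- The integral of the squared density. -/
def densQuad {d : ℕ} (f : (Fin d → ℝ) → ℝ) : ℝ := ∫ x, f x ^ 2

/-- The set of densities `f`, bounded by `M`, with `∫ (f - fhat)² ≤ r`. -/
def densClass {d : ℕ} (M : ℝ) (fhat : (Fin d → ℝ) → ℝ) (r : ℝ) : Set ((Fin d → ℝ) → ℝ) :=
  {f | IsBoundedDensity M f ∧ ∫ x, (f x - fhat x) ^ 2 ≤ r}

/-- Minimax risk for the integral of the squared density. -/
def densMinimaxRisk {d : ℕ} (n : ℕ) (M : ℝ) (fhat : (Fin d → ℝ) → ℝ) (r : ℝ) : ℝ≥0∞ :=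
  minimaxRisk (densClass M fhat r) (densLaw n) densQuad

/-! ### Expected conditional covariance -/

/-- The unit cube `[0,1]^d`. -/
abbrev cube (d : ℕ) : Set (Fin d → ℝ) := Set.Icc 0 1

/-- A quadruple `(μ, π, η, p_X)`: `μ(x) = E[Y | X = x]`, `π(x) = E[A | X = x]`,
`η(x) = E[Y | X = x, A = 1] - E[Y | X = x, A = 0]`, and `p_X` is the density of the covariates. -/
structure CovParam (d : ℕ) where
  mu : (Fin d → ℝ) → ℝ
  pi : (Fin d → ℝ) → ℝ
  eta : (Fin d → ℝ) → ℝ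
  pX : (Fin d → ℝ) → ℝ

namespace CovParam

variable {d : ℕ}

/-- `P(Y = 1 | X = x, A = a)`. -/
def outcomeProb (q : CovParam d) (x : Fin d → ℝ) (a : Bool) : ℝ :=
  if a then q.mu x + (1 - q.pi x) * q.eta x else q.mu x - q.pi x * q.eta x

/-- The joint density of `(X, A, Y)` with respect to Lebesgue measure times counting measure on
`{0,1} × {0,1}`. -/
def likelihood (q : CovParam d) (z : (Fin d → ℝ) × Bool × Bool) : ℝ :=
  q.pX z.1 * (if z.2.1 then q.pi z.1 else 1 - q.pi z.1) *
    (if z.2.2 then q.outcomeProb z.1 z.2.1 else 1 - q.outcomeProb z.1 z.2.1)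

/-- The law of a single observation `(X, A, Y)`. -/
def law (q : CovParam d) : Measure ((Fin d → ℝ) × Bool × Bool) :=
  (volume.prod (Measure.count.prod Measure.count)).withDensity
    fun z => ENNReal.ofReal (q.likelihood z)

/-- The law of an i.i.d. sample `(X_i, A_i, Y_i)`, `i = 1, …, n`. -/
def sampleLaw (n : ℕ) (q : CovParam d) : Measure (Fin n → (Fin d → ℝ) × Bool × Bool) :=
  Measure.pi fun _ => q.law

/-- The expected conditional covariance `E[cov(A, Y | X)] = E[A Y] - ∫ π μ p_X`. -/
def psi (q : CovParam d) : ℝ :=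
  (∫ z, (if z.2.1 then 1 else 0) * (if z.2.2 then 1 else 0) ∂q.law) -
    ∫ x, q.pi x * q.mu x * q.pX x

end CovParam

/-- The set of quadruples, with uniform covariate density on `[0,1]^d`, for which `μ` is within
squared `L²` distance `r` of `muhat` and `π` is within squared `L²` distance `s` of `pihat`.
The field `outcomeProb_mem` says that the quadruple is a genuine distribution of `(X, A, Y)`. -/
structure InCovClass {d : ℕ} (muhat pihat : (Fin d → ℝ) → ℝ) (r s : ℝ) (q : CovParam d) :
    Prop where
  measurable_mu : Measurable q.mu
  measurable_pi : Measurable q.pi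
  measurable_eta : Measurable q.eta
  pX_uniform : q.pX = (cube d).indicator 1
  mu_mem : ∀ x ∈ cube d, q.mu x ∈ Set.Icc 0 1
  pi_mem : ∀ x ∈ cube d, q.pi x ∈ Set.Icc 0 1
  outcomeProb_mem : ∀ x ∈ cube d, ∀ a, q.outcomeProb x a ∈ Set.Icc 0 1
  mu_close : ∫ x, (q.mu x - muhat x) ^ 2 * q.pX x ≤ r
  pi_close : ∫ x, (q.pi x - pihat x) ^ 2 * q.pX x ≤ s

/-- Minimax risk for the expected conditional covariance. -/
def covMinimaxRisk {d : ℕ} (n : ℕ) (muhat pihat : (Fin d → ℝ) → ℝ) (r s : ℝ) : ℝ≥0∞ :=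
  minimaxRisk {q | InCovClass muhat pihat r s q} (CovParam.sampleLaw n) CovParam.psi

/-- A pilot estimate on `[0,1]^d` that is bounded away from `0` and `1` by `ε`. -/
structure IsPilot {d : ℕ} (ε : ℝ) (g : (Fin d → ℝ) → ℝ) : Prop where
  measurable : Measurable g
  mem : ∀ x ∈ cube d, g x ∈ Set.Icc ε (1 - ε)

end StructureAgnostic

end

/-! Each lower bound is a sum of two terms, hence up to a factor 2 their maximum, and each term
comes from a separate testing problem: thresholding an estimator gives a test, so hypotheses that
cannot be told apart but have separated functional values force a large risk
(`le_minimaxRisk_of_test`).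

The terms `r ^ 2` and `r * s`, which do not involve `n`, come from the failure of weak continuity of
a quadratic functional. For fixed `n` there are alternatives whose laws converge setwise to the null
law while the functional stays at a distance from its null value; every test then has total error
near 1 along the sequence (`le_minimaxRisk_of_setwiseTendsto`). In the sequence model a spike of
height `√r` moves to infinity: the centred likelihood ratios are orthogonal with a common norm, so
Bessel's inequality sends their integrals against bounded tests to 0. In the other two models the
perturbation is `sin (2πk x_i)`. The density of one observation is affine in it, so Riemann–Lebesgue
gives setwise convergence (`setwiseTendsto_withDensity`), which passes to samples of size `n` under
a finite dominating measure (`SetwiseTendsto.pi`). In the functional the square of the sine averages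
to 1/2, and half the product of the amplitudes survives (`tendsto_integral_mul_add_osc`). For the
covariance, `η` is chosen to keep `E[AY | X]` fixed; all cell probabilities are then affine in the
tilt and only `∫ πμ` sees the product.

The terms with `1 / n` are Le Cam two-point bounds (`le_minimaxRisk_of_chiSqLE`) with a single
alternative of size about `1 / √n`, or smaller if the radius requires it: a multiple of the pilot
sequence, a multiple of the influence function `f - ∫ f ^ 2` of the density functional, or a
constant effect `η = t`. The chi-square divergence is used in a dual form that is stable under
products and images. -/

noncomputable section

namespace StructureAgnostic

open Filter Topology

/-! ### Reduction to testing -/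

/-- If every test between `law θ₀` and some alternative `law θ₁`, with `T θ₁` separated from `T θ₀`,
has total error at least `γ`, then the minimax risk is bounded from below. -/
lemma le_minimaxRisk_of_test {P D : Type*} [MeasurableSpace D] {Θ : Set P} {law : P → Measure D}
    {T : P → ℝ} {θ₀ : P} (h₀ : θ₀ ∈ Θ) {s : ℝ} (hs : 0 ≤ s) {γ : ℝ≥0∞}
    (H : ∀ A, MeasurableSet A →
      ∃ θ₁ ∈ Θ, 2 * s ≤ |T θ₁ - T θ₀| ∧ γ ≤ law θ₀ Aᶜ + law θ₁ A) :
    γ * ENNReal.ofReal (s ^ 2) / 2 ≤ minimaxRisk Θ law T := by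
  refine le_iInf₂ fun est hest => ?_
  set R := ⨆ θ ∈ Θ, ∫⁻ x, ENNReal.ofReal ((est x - T θ) ^ 2) ∂(law θ) with hR
  have key : ∀ θ ∈ Θ, ∀ B : Set D, (∀ x ∈ B, s ≤ |est x - T θ|) →
      ENNReal.ofReal (s ^ 2) * law θ B ≤ R := by
    intro θ hθ B hB
    calc ENNReal.ofReal (s ^ 2) * law θ B
        ≤ ENNReal.ofReal (s ^ 2) *
            law θ {x | ENNReal.ofReal (s ^ 2) ≤ ENNReal.ofReal ((est x - T θ) ^ 2)} := by
          gcongr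
          intro x hx
          refine ENNReal.ofReal_le_ofReal ?_
          rw [← sq_abs (est x - T θ)]
          exact pow_le_pow_left₀ hs (hB x hx) 2
      _ ≤ ∫⁻ x, ENNReal.ofReal ((est x - T θ) ^ 2) ∂(law θ) :=
          mul_meas_ge_le_lintegral (by fun_prop) _
      _ ≤ R := le_iSup₂ (f := fun θ (_ : θ ∈ Θ) =>
          ∫⁻ x, ENNReal.ofReal ((est x - T θ) ^ 2) ∂(law θ)) θ hθ
  -- The test accepts `θ₀` when the estimate is within `s` of `T θ₀`. Either kind of test error then
  -- costs at least `s` in estimation, by the separation `2 * s`.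
  obtain ⟨θ₁, h₁, hsep, hγ⟩ := H {x | |est x - T θ₀| < s}
    (measurableSet_lt (by fun_prop) measurable_const)
  have e₀ := key θ₀ h₀ {x | |est x - T θ₀| < s}ᶜ (fun x hx => by simpa using hx)
  have e₁ := key θ₁ h₁ {x | |est x - T θ₀| < s} (fun x hx => by
    have hx' : |est x - T θ₀| < s := hx
    have := abs_sub_le (T θ₁) (est x) (T θ₀)
    rw [abs_sub_comm (T θ₁) (est x)] at this
    linarith)
  refine ENNReal.div_le_of_le_mul ?_
  calc γ * ENNReal.ofReal (s ^ 2)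
      ≤ (law θ₀ {x | |est x - T θ₀| < s}ᶜ + law θ₁ {x | |est x - T θ₀| < s}) *
          ENNReal.ofReal (s ^ 2) := by gcongr
    _ ≤ R + R := by rw [add_mul, mul_comm, mul_comm (law θ₁ _)]; exact add_le_add e₀ e₁
    _ = R * 2 := by rw [mul_two]

/-! ### Chi-square bounds -/

/-- The dual form of `1 + χ²(Q, P) ≤ B`. -/
def ChiSqLE {Ω : Type*} [MeasurableSpace Ω] (P Q : Measure Ω) (B : ℝ≥0∞) : Prop :=
  ∀ φ : Ω → ℝ≥0∞, Measurable φ → (∫⁻ x, φ x ∂Q) ^ 2 ≤ B * ∫⁻ x, φ x ^ 2 ∂P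

section ChiSq

variable {Ω Ω' : Type*} [MeasurableSpace Ω] [MeasurableSpace Ω']

lemma sq_lintegral_mul_le (m : Measure Ω) {f g : Ω → ℝ≥0∞} (hf : Measurable f)
    (hg : Measurable g) :
    (∫⁻ x, f x * g x ∂m) ^ 2 ≤ (∫⁻ x, f x ^ 2 ∂m) * ∫⁻ x, g x ^ 2 ∂m := by
  have h := ENNReal.lintegral_mul_le_Lp_mul_Lq m Real.HolderConjugate.two_two
    hf.aemeasurable hg.aemeasurable
  have h2 := pow_le_pow_left' h 2
  rw [mul_pow, ← ENNReal.rpow_natCast, ← ENNReal.rpow_natCast, ← ENNReal.rpow_natCast,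
    ← ENNReal.rpow_mul, ← ENNReal.rpow_mul] at h2
  norm_num at h2
  simpa using h2

/-- A chi-square bound from densities: `Q = f₁ m`, `P = f₀ m`, `f₁² / f₀ ≤ w`. -/
lemma ChiSqLE.of_density {m : Measure Ω} {f₀ f₁ w : Ω → ℝ≥0∞} (h₀ : Measurable f₀)
    (h₁ : Measurable f₁) (hw : Measurable w) (h : ∀ x, f₁ x ^ 2 ≤ f₀ x * w x) {B : ℝ≥0∞}
    (hB : ∫⁻ x, w x ∂m ≤ B) :
    ChiSqLE (m.withDensity f₀) (m.withDensity f₁) B := by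
  intro φ hφ
  rw [lintegral_withDensity_eq_lintegral_mul _ h₁ hφ,
    lintegral_withDensity_eq_lintegral_mul _ h₀ (hφ.pow_const 2)]
  have hsq : ∀ a : ℝ≥0∞, (a ^ (1 / 2 : ℝ)) ^ 2 = a := fun a => by
    rw [← ENNReal.rpow_natCast, ← ENNReal.rpow_mul]; norm_num
  -- Stating the hypothesis as `f₁² ≤ f₀ w` avoids dividing by `f₀`; its square root is what
  -- Cauchy–Schwarz needs.
  have hle : ∀ x, f₁ x ≤ f₀ x ^ (1 / 2 : ℝ) * w x ^ (1 / 2 : ℝ) := fun x => by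
    rw [← ENNReal.mul_rpow_of_nonneg _ _ (by norm_num)]
    calc f₁ x = (f₁ x ^ 2) ^ (1 / 2 : ℝ) := by
          rw [← ENNReal.rpow_natCast, ← ENNReal.rpow_mul]; norm_num
      _ ≤ _ := ENNReal.rpow_le_rpow (h x) (by norm_num)
  calc (∫⁻ x, (f₁ * φ) x ∂m) ^ 2
      ≤ (∫⁻ x, (w x ^ (1 / 2 : ℝ)) * (f₀ x ^ (1 / 2 : ℝ) * φ x) ∂m) ^ 2 := by
        gcongr with x
        rw [Pi.mul_apply, ← mul_assoc, mul_comm (w x ^ _)]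
        gcongr
        exact hle x
    _ ≤ (∫⁻ x, (w x ^ (1 / 2 : ℝ)) ^ 2 ∂m) * ∫⁻ x, (f₀ x ^ (1 / 2 : ℝ) * φ x) ^ 2 ∂m :=
        sq_lintegral_mul_le m (hw.pow_const _) ((h₀.pow_const _).mul hφ)
    _ ≤ B * ∫⁻ x, (f₀ * fun x => φ x ^ 2) x ∂m := by
        simp only [mul_pow, hsq, Pi.mul_apply]
        gcongr

lemma ChiSqLE.refl (P : Measure Ω) [IsProbabilityMeasure P] : ChiSqLE P P 1 := by
  intro φ hφ
  have := sq_lintegral_mul_le P (measurable_const (a := (1 : ℝ≥0∞))) hφ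
  simpa using this

lemma ChiSqLE.mono {P Q : Measure Ω} {B B' : ℝ≥0∞} (h : ChiSqLE P Q B) (hB : B ≤ B') :
    ChiSqLE P Q B' := fun φ hφ => (h φ hφ).trans (by gcongr)

/-- The dual form tensorizes by Fubini: the first bound is applied to the partial integral of `φ`,
the second to each slice. No likelihood ratio is needed. -/
lemma ChiSqLE.prod {P Q : Measure Ω} {P' Q' : Measure Ω'} [SFinite P'] [SFinite Q']
    {B B' : ℝ≥0∞} (h : ChiSqLE P Q B) (h' : ChiSqLE P' Q' B') :
    ChiSqLE (P.prod P') (Q.prod Q') (B * B') := by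
  intro φ hφ
  rw [lintegral_prod _ hφ.aemeasurable, lintegral_prod _ (hφ.pow_const 2).aemeasurable]
  refine (h _ hφ.lintegral_prod_right').trans ?_
  rw [mul_assoc, ← lintegral_const_mul _ (hφ.pow_const 2).lintegral_prod_right']
  gcongr with x
  exact h' _ (hφ.comp measurable_prodMk_left)

lemma ChiSqLE.map {P Q : Measure Ω} {B : ℝ≥0∞} (h : ChiSqLE P Q B) {g : Ω → Ω'}
    (hg : Measurable g) : ChiSqLE (P.map g) (Q.map g) B := by
  intro φ hφ
  rw [lintegral_map hφ hg, lintegral_map (hφ.pow_const 2) hg]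
  exact h _ (hφ.comp hg)

lemma pi_succ_eq_map (n : ℕ) (μ : Measure Ω) [SigmaFinite μ] :
    Measure.pi (fun _ : Fin (n + 1) => μ) =
      (μ.prod (Measure.pi fun _ : Fin n => μ)).map
        (MeasurableEquiv.piFinSuccAbove (fun _ : Fin (n + 1) => Ω) 0).symm :=
  ((measurePreserving_piFinSuccAbove (fun _ : Fin (n + 1) => μ) 0).symm).map_eq.symm

lemma ChiSqLE.pi {P Q : Measure Ω} [IsProbabilityMeasure P] [IsProbabilityMeasure Q] {B : ℝ≥0∞}
    (h : ChiSqLE P Q B) (n : ℕ) :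
    ChiSqLE (Measure.pi fun _ : Fin n => P) (Measure.pi fun _ : Fin n => Q) (B ^ n) := by
  induction n with
  | zero =>
    have : (Measure.pi fun _ : Fin 0 => Q) = Measure.pi fun _ : Fin 0 => P := by
      rw [Measure.pi_of_empty, Measure.pi_of_empty]
    rw [this, pow_zero]
    exact ChiSqLE.refl _
  | succ n ih =>
    rw [pi_succ_eq_map, pi_succ_eq_map, pow_succ']
    exact (h.prod ih).map (MeasurableEquiv.measurable _)

/-- A chi-square bound by `4` prevents the two laws from being told apart. -/
lemma ChiSqLE.test {P Q : Measure Ω} [IsProbabilityMeasure P] [IsProbabilityMeasure Q]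
    (h : ChiSqLE P Q 4) {A : Set Ω} (hA : MeasurableSet A) : 1 / 4 ≤ P Aᶜ + Q A := by
  -- With `u = P Aᶜ` and `v = Q Aᶜ` this reads `v² ≤ 4u`, so `u + 1 - v ≥ (1 - v/2)² ≥ 1/4` since `v
  -- ≤ 1`.
  have h1 := h (Aᶜ.indicator 1) (measurable_one.indicator hA.compl)
  have e : ∀ x, Aᶜ.indicator (1 : Ω → ℝ≥0∞) x ^ 2 = Aᶜ.indicator 1 x := fun x => by
    by_cases hx : x ∈ Aᶜ <;> simp [hx]
  simp only [e, lintegral_indicator_one hA.compl] at h1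
  have hQ : Q A = 1 - Q Aᶜ := by
    rw [prob_compl_eq_one_sub hA, ENNReal.sub_sub_cancel ENNReal.one_ne_top prob_le_one]
  rw [hQ]
  have hu := measure_ne_top P Aᶜ
  have hv := measure_ne_top Q Aᶜ
  have hv1 : Q Aᶜ ≤ 1 := prob_le_one
  generalize P Aᶜ = u at *
  generalize Q Aᶜ = v at *
  lift u to ℝ≥0 using hu
  lift v to ℝ≥0 using hv
  rw [show (1 / 4 : ℝ≥0∞) = ((1 / 4 : ℝ≥0) : ℝ≥0∞) by
    rw [ENNReal.coe_div (by norm_num)]; simp]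
  norm_cast at h1 hv1 ⊢
  rw [← NNReal.coe_le_coe] at h1 hv1 ⊢
  push_cast [NNReal.coe_sub hv1] at h1 hv1 ⊢
  nlinarith [sq_nonneg ((v : ℝ) - 1), u.2]

end ChiSq

lemma le_minimaxRisk_of_chiSqLE {P D : Type*} [MeasurableSpace D] {Θ : Set P}
    {law : P → Measure D} {T : P → ℝ} {θ₀ θ₁ : P} (h₀ : θ₀ ∈ Θ) (h₁ : θ₁ ∈ Θ)
    [IsProbabilityMeasure (law θ₀)] [IsProbabilityMeasure (law θ₁)]
    (h : ChiSqLE (law θ₀) (law θ₁) 4) {s : ℝ} (hs : 0 ≤ s) (hsep : 2 * s ≤ |T θ₁ - T θ₀|) :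
    ENNReal.ofReal (s ^ 2 / 8) ≤ minimaxRisk Θ law T := by
  refine le_trans (le_of_eq ?_) (le_minimaxRisk_of_test h₀ hs (γ := 1 / 4) fun A hA =>
    ⟨θ₁, h₁, hsep, h.test hA⟩)
  rw [ENNReal.ofReal_div_of_pos (by norm_num), ENNReal.div_eq_inv_mul, ENNReal.div_eq_inv_mul,
    one_div, ← mul_assoc, ← ENNReal.mul_inv (by simp) (by simp)]
  norm_num

/-! ### Setwise convergence -/

/-- Setwise convergence of measures, tested against bounded measurable functions. -/
def SetwiseTendsto {Ω : Type*} [MeasurableSpace Ω] (μ : ℕ → Measure Ω) (ν : Measure Ω) : Prop :=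
  ∀ φ : Ω → ℝ, Measurable φ → (∀ x, |φ x| ≤ 1) →
    Tendsto (fun k => ∫ x, φ x ∂(μ k)) atTop (𝓝 (∫ x, φ x ∂ν))

section Setwise

variable {Ω Ω' : Type*} [MeasurableSpace Ω] [MeasurableSpace Ω']

lemma integrable_of_abs_le_one {μ : Measure Ω} [IsFiniteMeasure μ] {φ : Ω → ℝ}
    (hφ : Measurable φ) (hb : ∀ x, |φ x| ≤ 1) : Integrable φ μ :=
  Integrable.of_bound hφ.aestronglyMeasurable 1 (ae_of_all _ hb)

lemma abs_integral_le_one {μ : Measure Ω} [IsProbabilityMeasure μ] {φ : Ω → ℝ}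
    (hb : ∀ x, |φ x| ≤ 1) : |∫ x, φ x ∂μ| ≤ 1 := by
  have := norm_integral_le_of_norm_le_const (μ := μ) (f := φ) (C := 1) (ae_of_all _ hb)
  simpa using this

lemma SetwiseTendsto.map {μ : ℕ → Measure Ω} {ν : Measure Ω} (h : SetwiseTendsto μ ν)
    {g : Ω → Ω'} (hg : Measurable g) : SetwiseTendsto (fun k => (μ k).map g) (ν.map g) := by
  intro φ hφ hb
  have e : ∀ m : Measure Ω, ∫ y, φ y ∂(m.map g) = ∫ x, φ (g x) ∂m := fun m =>
    integral_map hg.aemeasurable hφ.aestronglyMeasurable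
  simp only [e]
  exact h _ (hφ.comp hg) fun x => hb _

/-- The inner integrals `ψ k` converge only pointwise while the outer measure also moves. The finite
measure `η` above all `μ k` allows dominated convergence to replace `ψ k` by its limit uniformly in
the outer measure; the limit is then a fixed test function for `hμ`. -/
lemma SetwiseTendsto.prod {μ : ℕ → Measure Ω} {μ' : Measure Ω} {ν : ℕ → Measure Ω'}
    {ν' : Measure Ω'} {η : Measure Ω} [∀ k, IsProbabilityMeasure (μ k)] [IsProbabilityMeasure μ']
    [∀ k, IsProbabilityMeasure (ν k)] [IsProbabilityMeasure ν'] [IsFiniteMeasure η]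
    (hη : ∀ k, μ k ≤ η) (hμ : SetwiseTendsto μ μ') (hν : SetwiseTendsto ν ν') :
    SetwiseTendsto (fun k => (μ k).prod (ν k)) (μ'.prod ν') := by
  intro φ hφ hb
  set ψ : ℕ → Ω → ℝ := fun k x => ∫ y, φ (x, y) ∂(ν k) with hψ
  set ψ' : Ω → ℝ := fun x => ∫ y, φ (x, y) ∂ν' with hψ'
  have mψ : ∀ k, Measurable (ψ k) := fun k =>
    (hφ.stronglyMeasurable.integral_prod_right').measurable
  have mψ' : Measurable ψ' := (hφ.stronglyMeasurable.integral_prod_right').measurable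
  have bψ : ∀ k x, |ψ k x| ≤ 1 := fun k x => abs_integral_le_one fun y => hb _
  have bψ' : ∀ x, |ψ' x| ≤ 1 := fun x => abs_integral_le_one fun y => hb _
  have lim : ∀ x, Tendsto (fun k => ψ k x) atTop (𝓝 (ψ' x)) := fun x =>
    hν (fun y => φ (x, y)) (hφ.comp measurable_prodMk_left) fun y => hb _
  have main : Tendsto (fun k => ∫ x, |ψ k x - ψ' x| ∂η) atTop (𝓝 0) := by
    have := tendsto_integral_of_dominated_convergence (μ := η) (F := fun k x => |ψ k x - ψ' x|)
      (f := fun _ => 0) (fun _ => 2) (fun k => ((mψ k).sub mψ').abs.aestronglyMeasurable)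
      (integrable_const _) (fun k => ae_of_all _ fun x => by
        rw [Real.norm_eq_abs, abs_abs]
        have := abs_sub (ψ k x) (ψ' x)
        linarith [bψ k x, bψ' x]) (ae_of_all _ fun x => by
        have := ((lim x).sub_const (ψ' x)).abs
        simpa using this)
    simpa using this
  have small : Tendsto (fun k => ∫ x, ψ k x ∂(μ k) - ∫ x, ψ' x ∂(μ k)) atTop (𝓝 0) := by
    refine squeeze_zero_norm (fun k => ?_) main
    rw [← integral_sub (integrable_of_abs_le_one (mψ k) (bψ k))
      (integrable_of_abs_le_one mψ' bψ')]
    refine (norm_integral_le_integral_norm _).trans ?_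
    exact integral_mono_measure (hη k) (ae_of_all _ fun x => norm_nonneg _)
      ((integrable_of_abs_le_one (mψ k) (bψ k)).sub
        (integrable_of_abs_le_one mψ' bψ')).norm
  have e : ∀ k, ∫ z, φ z ∂((μ k).prod (ν k)) = ∫ x, ψ k x ∂(μ k) := fun k =>
    integral_prod _ (integrable_of_abs_le_one hφ hb)
  have e' : ∫ z, φ z ∂(μ'.prod ν') = ∫ x, ψ' x ∂μ' :=
    integral_prod _ (integrable_of_abs_le_one hφ hb)
  simp only [e, e']
  have := small.add (hμ ψ' mψ' bψ')
  simpa using this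

lemma SetwiseTendsto.pi {μ : ℕ → Measure Ω} {μ' : Measure Ω} {η : Measure Ω}
    [∀ k, IsProbabilityMeasure (μ k)] [IsProbabilityMeasure μ'] [IsFiniteMeasure η]
    (hη : ∀ k, μ k ≤ η) (hμ : SetwiseTendsto μ μ') (n : ℕ) :
    SetwiseTendsto (fun k => Measure.pi fun _ : Fin n => μ k) (Measure.pi fun _ : Fin n => μ') := by
  induction n with
  | zero =>
    intro φ _ _
    have : ∀ k, (Measure.pi fun _ : Fin 0 => μ k) = Measure.pi fun _ : Fin 0 => μ' := fun k => by
      rw [Measure.pi_of_empty, Measure.pi_of_empty]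
    simp only [this]
    exact tendsto_const_nhds
  | succ n ih =>
    simp only [pi_succ_eq_map]
    exact (SetwiseTendsto.prod hη hμ ih).map (MeasurableEquiv.measurable _)

lemma SetwiseTendsto.tendsto_measureReal {μ : ℕ → Measure Ω} {ν : Measure Ω}
    (h : SetwiseTendsto μ ν) {A : Set Ω} (hA : MeasurableSet A) :
    Tendsto (fun k => (μ k).real A) atTop (𝓝 (ν.real A)) := by
  have := h (A.indicator 1) (measurable_one.indicator hA) fun x => by
    by_cases hx : x ∈ A <;> simp [hx]
  simpa only [integral_indicator_one hA] using this

/-- Setwise convergence of measures whose densities are affine in a weakly null sequence. -/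
lemma setwiseTendsto_withDensity {m : Measure Ω} {ρ : ℕ → Ω → ℝ}
    (hρm : ∀ k, Measurable (ρ k)) (hρb : ∀ k x, |ρ k x| ≤ 1)
    (hρ : ∀ ψ : Ω → ℝ, Integrable ψ m → Tendsto (fun k => ∫ x, ψ x * ρ k x ∂m) atTop (𝓝 0))
    {u v : Ω → ℝ} (hu : Measurable u) (hv : Measurable v) (iu : Integrable u m)
    (iv : Integrable v m) (hu0 : ∀ x, 0 ≤ u x) (hnn : ∀ k x, 0 ≤ u x + v x * ρ k x) :
    SetwiseTendsto (fun k => m.withDensity fun x => ENNReal.ofReal (u x + v x * ρ k x))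
      (m.withDensity fun x => ENNReal.ofReal (u x)) := by
  intro φ hφ hb
  have e : ∀ f : Ω → ℝ, Measurable f → (∀ x, 0 ≤ f x) →
      ∫ x, φ x ∂(m.withDensity fun x => ENNReal.ofReal (f x)) = ∫ x, f x * φ x ∂m := by
    intro f hf h0
    rw [integral_withDensity_eq_integral_toReal_smul hf.ennreal_ofReal
      (ae_of_all _ fun x => ENNReal.ofReal_lt_top)]
    simp only [ENNReal.toReal_ofReal (h0 _), smul_eq_mul]
  rw [e u hu hu0]
  have bφ : ∀ f : Ω → ℝ, Integrable f m → Integrable (fun x => f x * φ x) m := fun f hf =>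
    hf.mul_bdd (c := 1) hφ.aestronglyMeasurable (ae_of_all _ hb)
  have lim := (hρ _ (bφ v iv)).const_add (∫ x, u x * φ x ∂m)
  rw [add_zero] at lim
  refine lim.congr fun k => ?_
  have ek := e (fun x => u x + v x * ρ k x) (hu.add (hv.mul (hρm k))) (hnn k)
  beta_reduce
  rw [ek, ← integral_add (bφ u iu) ((bφ v iv).mul_bdd (c := 1) (hρm k).aestronglyMeasurable
    (ae_of_all _ (hρb k)))]
  exact integral_congr_ae (ae_of_all _ fun x => by ring)

end Setwise

/-- The alternative may depend on the test: for each `A`, a late enough `k` has nearly the null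
probability of `A`. No rate of convergence is needed, so nothing is lost as `n` grows. -/
lemma le_minimaxRisk_of_setwiseTendsto {P D : Type*} [MeasurableSpace D] {Θ : Set P}
    {law : P → Measure D} {T : P → ℝ} {θ₀ : P} {θ : ℕ → P} (h₀ : θ₀ ∈ Θ) (h : ∀ k, θ k ∈ Θ)
    [IsProbabilityMeasure (law θ₀)] [∀ k, IsProbabilityMeasure (law (θ k))]
    (hlaw : SetwiseTendsto (fun k => law (θ k)) (law θ₀)) {t : ℝ}
    (hT : Tendsto (fun k => T (θ k)) atTop (𝓝 (T θ₀ + t))) :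
    ENNReal.ofReal (t ^ 2 / 64) ≤ minimaxRisk Θ law T := by
  rcases eq_or_ne t 0 with rfl | ht
  · simp
  -- The required separation `|t| / 2` and total error `1 / 2` lie strictly below the limits `|t|`
  -- and 1, so both hold eventually.
  have key := le_minimaxRisk_of_test (law := law) (T := T) h₀ (s := |t| / 4) (by positivity)
    (γ := 1 / 2) fun A hA => by
      have l1 := hlaw.tendsto_measureReal hA
      have l2 : ∀ᶠ k in atTop, (law θ₀).real A - 1 / 2 < (law (θ k)).real A :=
        l1.eventually (lt_mem_nhds (by linarith))
      have l3 : ∀ᶠ k in atTop, |t| / 2 < |T (θ k) - T θ₀| := by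
        have : Tendsto (fun k => |T (θ k) - T θ₀|) atTop (𝓝 |t|) := by
          simpa using (hT.sub_const (T θ₀)).abs
        exact this.eventually (lt_mem_nhds (by have := abs_pos.2 ht; linarith))
      obtain ⟨k, h2, h3⟩ := (l2.and l3).exists
      refine ⟨θ k, h k, by linarith, ?_⟩
      have hc : (law θ₀).real Aᶜ = 1 - (law θ₀).real A := probReal_compl_eq_one_sub hA
      rw [← ofReal_measureReal (μ := law θ₀) (s := Aᶜ),
        ← ofReal_measureReal (μ := law (θ k)) (s := A),
        ← ENNReal.ofReal_add measureReal_nonneg measureReal_nonneg,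
        show (1 / 2 : ℝ≥0∞) = ENNReal.ofReal (1 / 2) by
          rw [ENNReal.ofReal_div_of_pos (by norm_num)]; simp]
      exact ENNReal.ofReal_le_ofReal (by linarith)
  refine le_trans (le_of_eq ?_) key
  rw [show t ^ 2 / 64 = (|t| / 4) ^ 2 / 4 by rw [div_pow, sq_abs]; ring,
    ENNReal.ofReal_div_of_pos (by norm_num), ENNReal.div_eq_inv_mul, ENNReal.div_eq_inv_mul,
    one_div, ← mul_assoc, ← ENNReal.mul_inv (by simp) (by simp)]
  norm_num

/-! ### Modifying coordinates of an infinite product -/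

section InfinitePi

variable {ι E : Type*} [DecidableEq ι] [MeasurableSpace E]

lemma measurable_update_swap (k : ι) :
    Measurable fun p : E × (ι → E) => Function.update p.2 k p.1 := by
  refine measurable_pi_lambda _ fun j => ?_
  rcases eq_or_ne j k with rfl | h
  · simpa using measurable_fst
  · simp only [Function.update_of_ne h]
    fun_prop

instance isProbabilityMeasure_update (μ : ι → Measure E) [∀ i, IsProbabilityMeasure (μ i)] (k : ι)
    (ν : Measure E) [hν : IsProbabilityMeasure ν] (i : ι) :
    IsProbabilityMeasure (Function.update μ k ν i) := by
  rcases eq_or_ne i k with rfl | h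
  · simpa using hν
  · rw [Function.update_of_ne h]; infer_instance

lemma infinitePi_update (μ : ι → Measure E) [∀ i, IsProbabilityMeasure (μ i)] (k : ι)
    (ν : Measure E) [IsProbabilityMeasure ν] :
    Measure.infinitePi (Function.update μ k ν) =
      (ν.prod (Measure.infinitePi μ)).map fun p => Function.update p.2 k p.1 := by
  symm
  refine Measure.eq_infinitePi _ fun s t ht => ?_
  rw [Measure.map_apply (measurable_update_swap k)
    (MeasurableSet.pi s.countable_toSet fun i _ => ht i)]
  have hpre : (fun p : E × (ι → E) => Function.update p.2 k p.1) ⁻¹' ((s : Set ι).pi t) =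
      (if k ∈ s then t k else Set.univ) ×ˢ (((s.erase k : Finset ι) : Set ι).pi t) := by
    ext ⟨z, y⟩
    simp only [Set.mem_preimage, Set.mem_pi, Set.mem_prod, Finset.mem_coe, Finset.mem_erase]
    constructor
    · intro h
      refine ⟨?_, fun i hi => by simpa [Function.update_of_ne hi.1] using h i hi.2⟩
      split_ifs with hk
      · simpa using h k hk
      · trivial
    · rintro ⟨h1, h2⟩ i hi
      rcases eq_or_ne i k with rfl | hne
      · simpa [hi] using h1
      · simpa [Function.update_of_ne hne] using h2 i ⟨hne, hi⟩
  rw [hpre, Measure.prod_prod, Measure.infinitePi_pi _ fun i _ => ht i]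
  have hcongr : ∏ i ∈ s.erase k, Function.update μ k ν i (t i) = ∏ i ∈ s.erase k, μ i (t i) :=
    Finset.prod_congr rfl fun i hi => by rw [Function.update_of_ne (Finset.ne_of_mem_erase hi)]
  split_ifs with hk
  · rw [← Finset.mul_prod_erase s _ hk, Function.update_self, hcongr]
  · rw [Finset.erase_eq_of_notMem hk] at hcongr ⊢
    rw [hcongr, measure_univ, one_mul]

/-- Resampling one coordinate leaves a product law unchanged. Null and modified laws thus become
images of binary products under the same map. -/
lemma infinitePi_eq_map_update (μ : ι → Measure E) [∀ i, IsProbabilityMeasure (μ i)] (k : ι) :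
    Measure.infinitePi μ =
      ((μ k).prod (Measure.infinitePi μ)).map fun p => Function.update p.2 k p.1 := by
  have := infinitePi_update μ k (μ k)
  rwa [Function.update_eq_self] at this

lemma infinitePi_update_withDensity (μ : ι → Measure E) [∀ i, IsProbabilityMeasure (μ i)] (k : ι)
    {f : E → ℝ≥0∞} (hf : Measurable f) [IsProbabilityMeasure ((μ k).withDensity f)] :
    Measure.infinitePi (Function.update μ k ((μ k).withDensity f)) =
      (Measure.infinitePi μ).withDensity fun y => f (y k) := by
  refine Measure.ext_of_lintegral _ fun φ hφ => ?_
  have hfk : Measurable fun y : ι → E => f (y k) := hf.comp (measurable_pi_apply k)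
  have hm := measurable_update_swap (E := E) k
  have hint : Measurable fun p : E × (ι → E) => φ (Function.update p.2 k p.1) := hφ.comp hm
  rw [lintegral_withDensity_eq_lintegral_mul _ hfk hφ, infinitePi_update, lintegral_map hφ hm,
    lintegral_prod _ hint.aemeasurable,
    lintegral_withDensity_eq_lintegral_mul _ hf hint.lintegral_prod_right']
  conv_rhs => rw [infinitePi_eq_map_update μ k]
  have hint' : Measurable fun p : E × (ι → E) =>
      ((fun y : ι → E => f (y k)) * φ) (Function.update p.2 k p.1) := (hfk.mul hφ).comp hm
  rw [lintegral_map (hfk.mul hφ) hm, lintegral_prod _ hint'.aemeasurable]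
  refine lintegral_congr fun z => ?_
  simp only [Pi.mul_apply, Function.update_self]
  exact (lintegral_const_mul _ (hint.comp measurable_prodMk_left)).symm

/-- Induction on the set of changed coordinates: each new one is split off both laws by the same
update map, so `ChiSqLE.prod` and `ChiSqLE.map` apply. -/
lemma ChiSqLE.infinitePi {μ μ' : ι → Measure E} [∀ i, IsProbabilityMeasure (μ i)]
    [∀ i, IsProbabilityMeasure (μ' i)] {B : ι → ℝ≥0∞} (s : Finset ι)
    (h : ∀ i ∈ s, ChiSqLE (μ i) (μ' i) (B i)) :
    ChiSqLE (Measure.infinitePi μ) (Measure.infinitePi (s.piecewise μ' μ)) (∏ i ∈ s, B i) := by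
  induction s using Finset.induction_on with
  | empty =>
    rw [Finset.piecewise_empty, Finset.prod_empty]
    exact ChiSqLE.refl _
  | insert k s hk ih =>
    have : ∀ i, IsProbabilityMeasure (s.piecewise μ' μ i) := fun i => by
      rw [Finset.piecewise]
      split_ifs <;> infer_instance
    rw [Finset.piecewise_insert, infinitePi_update, Finset.prod_insert hk]
    conv in Measure.infinitePi μ => rw [infinitePi_eq_map_update μ k]
    exact ((h k (Finset.mem_insert_self _ _)).prod
      (ih fun i hi => h i (Finset.mem_insert_of_mem hi))).map (measurable_update_swap k)

end InfinitePi

/-! ### Gaussian shifts -/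

/-- Completing the square, the squared density at mean `m + h` is `exp (h² / v)` times the product
of the densities at means `m` and `m + 2h`. -/
lemma chiSqLE_gaussianReal (m h : ℝ) {v : ℝ≥0} (hv : v ≠ 0) :
    ChiSqLE (gaussianReal m v) (gaussianReal (m + h) v) (ENNReal.ofReal (Real.exp (h ^ 2 / v))) := by
  rw [gaussianReal_of_var_ne_zero _ hv, gaussianReal_of_var_ne_zero _ hv]
  refine ChiSqLE.of_density
    (w := fun x => ENNReal.ofReal (Real.exp (h ^ 2 / v)) * gaussianPDF (m + 2 * h) v x)
    (measurable_gaussianPDF _ _) (measurable_gaussianPDF _ _)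
    ((measurable_gaussianPDF _ _).const_mul _) (fun x => le_of_eq ?_) ?_
  · have hv' : (v : ℝ) ≠ 0 := by exact_mod_cast hv
    simp only [gaussianPDF]
    rw [← ENNReal.ofReal_mul (Real.exp_nonneg _),
      ← ENNReal.ofReal_mul (gaussianPDFReal_nonneg _ _ _),
      ← ENNReal.ofReal_pow (gaussianPDFReal_nonneg _ _ _)]
    congr 1
    simp only [gaussianPDFReal]
    have : Real.exp (-(x - (m + h)) ^ 2 / (2 * v)) ^ 2 =
        Real.exp (-(x - m) ^ 2 / (2 * v)) *
          (Real.exp (h ^ 2 / v) * Real.exp (-(x - (m + 2 * h)) ^ 2 / (2 * v))) := by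
      rw [sq, ← Real.exp_add, ← Real.exp_add, ← Real.exp_add]
      congr 1
      field_simp
      ring
    rw [mul_pow, this]
    ring
  · rw [lintegral_const_mul _ (measurable_gaussianPDF _ _), lintegral_gaussianPDF_eq_one _ hv,
      mul_one]

/-- The likelihood ratio of `N(m + h, v)` with respect to `N(m, v)`. -/
def gaussianRatio (m : ℝ) (v : ℝ≥0) (h x : ℝ) : ℝ :=
  Real.exp (h / v * x - (m * (h / v) + v * (h / v) ^ 2 / 2))

lemma measurable_gaussianRatio (m : ℝ) (v : ℝ≥0) (h : ℝ) : Measurable (gaussianRatio m v h) := by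
  unfold gaussianRatio
  fun_prop

lemma gaussianReal_add_eq_withDensity (m h : ℝ) {v : ℝ≥0} (hv : v ≠ 0) :
    gaussianReal (m + h) v =
      (gaussianReal m v).withDensity fun x => ENNReal.ofReal (gaussianRatio m v h x) := by
  have hv' : (v : ℝ) ≠ 0 := by exact_mod_cast hv
  rw [gaussianReal_of_var_ne_zero _ hv, gaussianReal_of_var_ne_zero _ hv,
    ← withDensity_mul _ (measurable_gaussianPDF _ _) (measurable_gaussianRatio m v h).ennreal_ofReal]
  congr 1
  ext x
  simp only [gaussianPDF, Pi.mul_apply]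
  rw [← ENNReal.ofReal_mul (gaussianPDFReal_nonneg _ _ _)]
  congr 1
  simp only [gaussianPDFReal, gaussianRatio]
  have : Real.exp (-(x - (m + h)) ^ 2 / (2 * v)) = Real.exp (-(x - m) ^ 2 / (2 * v)) *
      Real.exp (h / v * x - (m * (h / v) + v * (h / v) ^ 2 / 2)) := by
    rw [← Real.exp_add]
    congr 1
    field_simp
    ring
  rw [this]
  ring

lemma integrable_gaussianRatio (m h : ℝ) (v : ℝ≥0) :
    Integrable (gaussianRatio m v h) (gaussianReal m v) := by
  have : gaussianRatio m v h = fun x =>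
      Real.exp (h / v * x) * Real.exp (-(m * (h / v) + v * (h / v) ^ 2 / 2)) := by
    ext x
    rw [gaussianRatio, sub_eq_add_neg, Real.exp_add]
  rw [this]
  exact (integrable_exp_mul_gaussianReal _).mul_const _

lemma integral_exp_mul_gaussianReal (m t : ℝ) (v : ℝ≥0) :
    ∫ x, Real.exp (t * x) ∂(gaussianReal m v) = Real.exp (m * t + v * t ^ 2 / 2) :=
  congrFun (mgf_id_gaussianReal (μ := m) (v := v)) t

lemma integral_gaussianRatio (m h : ℝ) (v : ℝ≥0) :
    ∫ x, gaussianRatio m v h x ∂(gaussianReal m v) = 1 := by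
  simp only [gaussianRatio, sub_eq_add_neg, Real.exp_add]
  rw [integral_mul_const, integral_exp_mul_gaussianReal, ← Real.exp_add]
  simp

lemma gaussianRatio_sq (m h : ℝ) {v : ℝ≥0} (hv : v ≠ 0) (x : ℝ) :
    gaussianRatio m v h x ^ 2 = Real.exp (h ^ 2 / v) * gaussianRatio m v (2 * h) x := by
  have hv' : (v : ℝ) ≠ 0 := by exact_mod_cast hv
  simp only [gaussianRatio]
  rw [sq, ← Real.exp_add, ← Real.exp_add]
  congr 1
  field_simp
  ring

/-! ### Bessel's inequality for bounded test functions -/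

/-- After division by `√b` the `g k` are orthonormal in `L²(P)`, so by Bessel the coefficients of
`φ` are square summable. -/
lemma tendsto_integral_mul_of_orthogonal {Ω : Type*} [MeasurableSpace Ω] {P : Measure Ω}
    [IsProbabilityMeasure P] {g : ℕ → Ω → ℝ} {b : ℝ} (hb : 0 < b) (hg : ∀ k, MemLp (g k) 2 P)
    (hsq : ∀ k, ∫ x, g k x ^ 2 ∂P = b) (hort : Pairwise fun j k => ∫ x, g j x * g k x ∂P = 0)
    {φ : Ω → ℝ} (hφ : MemLp φ 2 P) :
    Tendsto (fun k => ∫ x, φ x * g k x ∂P) atTop (𝓝 0) := by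
  have hin : ∀ {f₁ f₂ : Ω → ℝ} (h₁ : MemLp f₁ 2 P) (h₂ : MemLp f₂ 2 P),
      inner ℝ (h₁.toLp f₁) (h₂.toLp f₂) = ∫ x, f₁ x * f₂ x ∂P := by
    intro f₁ f₂ h₁ h₂
    rw [L2.inner_def]
    refine integral_congr_ae ?_
    filter_upwards [h₁.coeFn_toLp, h₂.coeFn_toLp] with x e₁ e₂
    rw [e₁, e₂]
    simp [mul_comm]
  have hsqrt : 0 < Real.sqrt b := Real.sqrt_pos.2 hb
  set v : ℕ → Lp ℝ 2 P := fun k => (Real.sqrt b)⁻¹ • (hg k).toLp (g k) with hv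
  have hvo : Orthonormal ℝ v := by
    rw [orthonormal_iff_ite]
    intro j k
    simp only [hv, inner_smul_left, inner_smul_right, hin]
    split_ifs with hjk
    · subst hjk
      simp only [← sq, hsq]
      rw [← mul_assoc]
      have : (Real.sqrt b)⁻¹ * (Real.sqrt b)⁻¹ * b = 1 := by
        rw [← mul_inv, Real.mul_self_sqrt hb.le, inv_mul_cancel₀ hb.ne']
      simpa using this
    · rw [hort hjk]; simp
  have hlim := (hvo.inner_products_summable (hφ.toLp φ)).tendsto_atTop_zero
  have h2 : Tendsto (fun k => ‖inner ℝ (v k) (hφ.toLp φ)‖) atTop (𝓝 0) := by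
    have := hlim.sqrt
    simpa [Real.sqrt_sq_eq_abs] using this
  have h3 := (tendsto_zero_iff_norm_tendsto_zero.2 h2).const_mul (Real.sqrt b)
  rw [mul_zero] at h3
  refine h3.congr fun k => ?_
  simp only [hv, inner_smul_left, hin]
  simp only [conj_trivial]
  rw [← mul_assoc, mul_inv_cancel₀ hsqrt.ne', one_mul]
  exact integral_congr_ae (ae_of_all _ fun x => mul_comm _ _)

/-- Sparse shifts of a Gaussian sequence become undetectable as the position of the shift tends
to infinity. -/
lemma setwiseTendsto_gaussian_spike (m : ℕ → ℝ) {h : ℝ} (hh : h ≠ 0) {v : ℝ≥0} (hv : v ≠ 0) :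
    SetwiseTendsto
      (fun k => Measure.infinitePi
        (Function.update (fun j => gaussianReal (m j) v) k (gaussianReal (m k + h) v)))
      (Measure.infinitePi fun j => gaussianReal (m j) v) := by
  intro φ hφ hb
  set P := Measure.infinitePi fun j => gaussianReal (m j) v with hP
  have hv' : (0 : ℝ) < v := by exact_mod_cast pos_iff_ne_zero.2 hv
  set L : ℕ → (ℕ → ℝ) → ℝ := fun k y => gaussianRatio (m k) v h (y k) with hL
  have mL : ∀ k, Measurable (L k) := fun k =>
    (measurable_gaussianRatio _ _ _).comp (measurable_pi_apply k)
  have ev : ∀ (k : ℕ) (f : ℝ → ℝ), Measurable f →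
      ∫ y, f (y k) ∂P = ∫ x, f x ∂(gaussianReal (m k) v) := by
    intro k f hf
    rw [← Measure.infinitePi_map_eval (fun j => gaussianReal (m j) v) k,
      integral_map (measurable_pi_apply k).aemeasurable hf.aestronglyMeasurable]
  have iev : ∀ (k : ℕ) (f : ℝ → ℝ), Integrable f (gaussianReal (m k) v) →
      Integrable (fun y => f (y k)) P := fun k f hf =>
    (measurePreserving_eval_infinitePi (fun j => gaussianReal (m j) v) k).integrable_comp_of_integrable
      hf
  have iL : ∀ k, Integrable (L k) P := fun k => iev k _ (integrable_gaussianRatio _ _ _)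
  have eL : ∀ k, ∫ y, L k y ∂P = 1 := fun k =>
    (ev k _ (measurable_gaussianRatio _ _ _)).trans (integral_gaussianRatio _ _ _)
  have iL2 : ∀ k, Integrable (fun y => L k y ^ 2) P := fun k => by
    simp only [hL, gaussianRatio_sq _ _ hv]
    exact (iev k _ (by
      have := integrable_gaussianRatio (m k) (2 * h) v
      exact this)).const_mul _
  have eL2 : ∀ k, ∫ y, L k y ^ 2 ∂P = Real.exp (h ^ 2 / v) := fun k => by
    simp only [hL, gaussianRatio_sq _ _ hv]
    rw [integral_const_mul, ev k _ (measurable_gaussianRatio _ _ _), integral_gaussianRatio, mul_one]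
  have hmem : ∀ k, MemLp (fun y => L k y - 1) 2 P := fun k =>
    ((memLp_two_iff_integrable_sq (mL k).aestronglyMeasurable).2 (iL2 k)).sub (memLp_const 1)
  have hind : iIndepFun L P := iIndepFun_infinitePi (X := fun k => gaussianRatio (m k) v h)
    fun k => measurable_gaussianRatio _ _ _
  -- The centred ratios depend on different coordinates, so independence makes them orthogonal;
  -- their common variance `exp (h² / v) - 1` is positive because `h ≠ 0`.
  have hmain := tendsto_integral_mul_of_orthogonal (P := P) (g := fun k y => L k y - 1)
    (b := Real.exp (h ^ 2 / v) - 1) (φ := φ)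
    (by
      have : 0 < h ^ 2 / v := by positivity
      linarith [Real.add_one_lt_exp this.ne'])
    hmem
    (fun k => by
      have : ∀ y, (L k y - 1) ^ 2 = L k y ^ 2 - (2 * L k y - 1) := fun y => by ring
      simp only [this]
      have i1 : Integrable (fun y => 2 * L k y - 1) P :=
        ((iL k).const_mul 2).sub (integrable_const 1)
      rw [integral_sub (iL2 k) i1, integral_sub ((iL k).const_mul 2) (integrable_const 1), integral_const_mul, eL, eL2]
      simp
      ring)
    (fun j k hjk => by
      have hI : IndepFun (fun y => L j y - 1) (fun y => L k y - 1) P :=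
        (hind.indepFun hjk).comp (φ := fun x => x - 1) (ψ := fun x => x - 1)
          (by fun_prop) (by fun_prop)
      beta_reduce
      rw [hI.integral_fun_mul_eq_mul_integral (hmem j).1 (hmem k).1,
        integral_sub (iL j) (integrable_const 1), eL]
      simp)
    ((memLp_const (1 : ℝ)).mono hφ.aestronglyMeasurable (ae_of_all _ fun x => by
      simpa using hb x))
  have hlim := hmain.const_add (∫ y, φ y ∂P)
  rw [add_zero] at hlim
  refine hlim.congr fun k => ?_
  have hprob : IsProbabilityMeasure ((gaussianReal (m k) v).withDensity
      fun x => ENNReal.ofReal (gaussianRatio (m k) v h x)) := by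
    rw [← gaussianReal_add_eq_withDensity _ _ hv]; infer_instance
  have hup := infinitePi_update_withDensity (fun j => gaussianReal (m j) v) k
    (measurable_gaussianRatio (m k) v h).ennreal_ofReal
  beta_reduce
  rw [gaussianReal_add_eq_withDensity _ _ hv, hup,
    integral_withDensity_eq_integral_toReal_smul (mL k).ennreal_ofReal
      (ae_of_all _ fun x => ENNReal.ofReal_lt_top)]
  have i1 : Integrable φ P := integrable_of_abs_le_one hφ hb
  have i2 : Integrable (fun y => φ y * L k y) P :=
    (iL k).bdd_mul (c := 1) hφ.aestronglyMeasurable (ae_of_all _ hb)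
  have i3 : Integrable (fun y => φ y * (L k y - 1)) P := by
    simp only [mul_sub, mul_one]; exact i2.sub i1
  rw [← integral_add i1 i3]
  refine integral_congr_ae (ae_of_all _ fun y => ?_)
  have h0 : 0 ≤ gaussianRatio (m k) v h (y k) := Real.exp_nonneg _
  simp only [ENNReal.toReal_ofReal h0, smul_eq_mul, hL]
  ring

/-! ### Lower bound in the Gaussian sequence model -/

lemma seqQuad_eq_norm_sq (θ : SeqSpace) : seqQuad θ = ‖θ‖ ^ 2 := by
  rw [← real_inner_self_eq_norm_sq, lp.inner_eq_tsum]
  exact tsum_congr fun j => by simp [sq]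

lemma summable_sq (θ : SeqSpace) : Summable fun j => θ j ^ 2 := by
  have := lp.summable_inner (𝕜 := ℝ) θ θ
  simpa [sq] using this

lemma seqQuad_add (θ h : SeqSpace) :
    seqQuad (θ + h) = seqQuad θ + (2 * inner ℝ θ h + ‖h‖ ^ 2) := by
  simp only [seqQuad_eq_norm_sq]
  rw [norm_add_sq_real]
  ring

instance isProbabilityMeasure_seqLaw (n : ℕ) (θ : SeqSpace) :
    IsProbabilityMeasure (seqLaw n θ) := by
  unfold seqLaw
  infer_instance

lemma add_mem_seqClass {θ h : SeqSpace} {r : ℝ} (hr : ‖h‖ ^ 2 ≤ r) : θ + h ∈ seqClass θ r := by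
  simpa [seqClass] using hr

lemma self_mem_seqClass (θ : SeqSpace) {r : ℝ} (hr : 0 ≤ r) : θ ∈ seqClass θ r := by
  simpa [seqClass] using hr

/-- The sequence with the single non-zero entry `a`, at position `k`. -/
def spike (k : ℕ) (a : ℝ) : SeqSpace := lp.single 2 k a

lemma norm_spike_sq (k : ℕ) (a : ℝ) : ‖spike k a‖ ^ 2 = a ^ 2 := by
  rw [spike, lp.norm_single (by norm_num), Real.norm_eq_abs, sq_abs]

lemma inner_spike (θ : SeqSpace) (k : ℕ) (a : ℝ) : inner ℝ θ (spike k a) = θ k * a := by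
  rw [spike, lp.inner_single_right]
  simp [mul_comm]

lemma seqLaw_add_spike (n : ℕ) (θ : SeqSpace) (k : ℕ) (a : ℝ) :
    seqLaw n (θ + spike k a) = Measure.infinitePi
      (Function.update (fun j => gaussianReal (θ j) (n : ℝ≥0)⁻¹) k
        (gaussianReal (θ k + a) (n : ℝ≥0)⁻¹)) := by
  unfold seqLaw
  congr 1
  ext1 j
  rw [lp.coeFn_add, Pi.add_apply, spike]
  rcases eq_or_ne j k with rfl | hjk
  · rw [Function.update_self, lp.single_apply_self]
  · rw [Function.update_of_ne hjk, lp.single_apply_ne _ _ _ hjk, add_zero]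

/-- The contribution of the radius: a sparse alternative at a far away coordinate. -/
lemma seqMinimaxRisk_ge_radius {n : ℕ} (hn : 1 ≤ n) (θ : SeqSpace) {r : ℝ} (hr : 0 ≤ r) :
    ENNReal.ofReal (r ^ 2 / 64) ≤ seqMinimaxRisk n θ r := by
  rcases hr.eq_or_lt with rfl | hr
  · simp
  have hv : (n : ℝ≥0)⁻¹ ≠ 0 := inv_ne_zero (by exact_mod_cast (by lia : n ≠ 0))
  have hnorm : ∀ k, ‖spike k (Real.sqrt r)‖ ^ 2 = r := fun k => by
    rw [norm_spike_sq, Real.sq_sqrt hr.le]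
  refine le_minimaxRisk_of_setwiseTendsto (θ₀ := θ)
    (θ := fun k => θ + spike k (Real.sqrt r)) (self_mem_seqClass θ hr.le)
    (fun k => add_mem_seqClass (hnorm k).le) ?_ ?_
  · simp only [seqLaw_add_spike]
    exact setwiseTendsto_gaussian_spike _ (Real.sqrt_ne_zero'.2 hr) hv
  · simp only [seqQuad_add, hnorm, inner_spike]
    have h0 : Tendsto (fun k => θ k) atTop (𝓝 0) := by
      rw [tendsto_zero_iff_abs_tendsto_zero]
      have := (summable_sq θ).tendsto_atTop_zero.sqrt
      simpa [Real.sqrt_sq_eq_abs, Function.comp_def] using this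
    have h1 : Tendsto (fun k => seqQuad θ + (2 * (θ k * Real.sqrt r) + r)) atTop
        (𝓝 (seqQuad θ + (2 * (0 * Real.sqrt r) + r))) :=
      (((h0.mul_const _).const_mul 2).add_const r).const_add _
    simpa [mul_comm] using h1

/-- The contribution of the linear term: a shift in the direction of the pilot estimate. -/
lemma seqMinimaxRisk_ge_linear {n : ℕ} (hn : 1 ≤ n) (θ : SeqSpace) {r : ℝ} (hr : 0 ≤ r) :
    ENNReal.ofReal (‖θ‖ ^ 2 * min r (1 / (n : ℝ)) / 32) ≤ seqMinimaxRisk n θ r := by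
  rcases eq_or_ne θ 0 with rfl | hθ
  · simp
  have hN : 0 < ‖θ‖ := norm_pos_iff.2 hθ
  have hn0 : (0 : ℝ) < n := by exact_mod_cast (by lia : 0 < n)
  have hv : (n : ℝ≥0)⁻¹ ≠ 0 := inv_ne_zero (by exact_mod_cast (by lia : n ≠ 0))
  set t := Real.sqrt (min r (1 / (n : ℝ))) with ht
  have ht2 : t ^ 2 = min r (1 / (n : ℝ)) := Real.sq_sqrt (le_min hr (by positivity))
  have ht0 : 0 ≤ t := Real.sqrt_nonneg _
  have hsum : HasSum (fun j => θ j ^ 2) (‖θ‖ ^ 2) := by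
    rw [← seqQuad_eq_norm_sq]; exact (summable_sq θ).hasSum
  -- The chi-square bound handles finitely many coordinates. Truncating the direction `θ` to a set
  -- carrying half of its energy costs only a constant.
  obtain ⟨s, hs⟩ : ∃ s : Finset ℕ, ‖θ‖ ^ 2 / 2 < ∑ j ∈ s, θ j ^ 2 :=
    (hsum.eventually (lt_mem_nhds (half_lt_self (by positivity)))).exists
  have hs' : ∑ j ∈ s, θ j ^ 2 ≤ ‖θ‖ ^ 2 := sum_le_hasSum s (fun j _ => sq_nonneg _) hsum
  set c := t / ‖θ‖ with hc
  have hc0 : 0 ≤ c := by positivity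
  set h : SeqSpace := ∑ j ∈ s, lp.single 2 j (c * θ j) with hh
  have hhnorm : ‖h‖ ^ 2 = c ^ 2 * ∑ j ∈ s, θ j ^ 2 := by
    have := lp.norm_sum_single (p := 2) (by norm_num) (fun j : ℕ => c * θ j) s
    simp only [ENNReal.toReal_ofNat, Real.rpow_ofNat, Real.norm_eq_abs, sq_abs, mul_pow] at this
    rw [hh, this, Finset.mul_sum]
  have hc2 : c ^ 2 * ‖θ‖ ^ 2 = t ^ 2 := by rw [hc]; field_simp
  have hhle : ‖h‖ ^ 2 ≤ t ^ 2 := by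
    rw [hhnorm, ← hc2]; gcongr
  have hinner : inner ℝ θ h = c * ∑ j ∈ s, θ j ^ 2 := by
    rw [hh, inner_sum, Finset.mul_sum]
    refine Finset.sum_congr rfl fun j _ => ?_
    rw [lp.inner_single_right]
    simp
    ring
  have hcoord : ∀ j, (θ + h) j = if j ∈ s then θ j + c * θ j else θ j := by
    intro j
    rw [lp.coeFn_add, Pi.add_apply, hh, lp.coeFn_sum, Finset.sum_apply]
    simp only [lp.coeFn_single, Finset.sum_pi_single]
    split_ifs <;> simp
  have hlaw : seqLaw n (θ + h) = Measure.infinitePi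
      (s.piecewise (fun j => gaussianReal (θ j + c * θ j) (n : ℝ≥0)⁻¹)
        fun j => gaussianReal (θ j) (n : ℝ≥0)⁻¹) := by
    unfold seqLaw
    congr 1
    ext1 j
    rw [hcoord, Finset.piecewise]
    split_ifs <;> rfl
  have hchi : ChiSqLE (seqLaw n θ) (seqLaw n (θ + h)) 4 := by
    rw [hlaw]
    refine (ChiSqLE.infinitePi s (fun j _ => chiSqLE_gaussianReal (θ j) (c * θ j) hv)).mono ?_
    rw [← ENNReal.ofReal_prod_of_nonneg fun _ _ => Real.exp_nonneg _, ← Real.exp_sum,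
      show (4 : ℝ≥0∞) = ENNReal.ofReal 4 by simp]
    refine ENNReal.ofReal_le_ofReal ?_
    have : ∑ j ∈ s, (c * θ j) ^ 2 / (((n : ℝ≥0)⁻¹ : ℝ≥0) : ℝ) = n * ‖h‖ ^ 2 := by
      rw [hhnorm, Finset.mul_sum, Finset.mul_sum]
      -- The variance is `1 / n`, so the exponents add up to `n * ‖h‖ ^ 2 ≤ 1`, and `e ≤ 4`.
      refine Finset.sum_congr rfl fun j _ => ?_
      push_cast
      field_simp
    rw [this]
    have h1 : n * ‖h‖ ^ 2 ≤ 1 := by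
      calc n * ‖h‖ ^ 2 ≤ n * (1 / (n : ℝ)) := by
            gcongr
            exact hhle.trans (ht2.le.trans (min_le_right _ _))
        _ = 1 := by field_simp
    linarith [Real.exp_le_exp.2 h1, Real.exp_one_lt_d9]
  refine le_trans (le_of_eq ?_) (le_minimaxRisk_of_chiSqLE (self_mem_seqClass θ hr)
    (add_mem_seqClass (hhle.trans (ht2.le.trans (min_le_left _ _)))) hchi
    (s := t * ‖θ‖ / 2) (by positivity) ?_)
  · congr 1
    rw [← ht2]
    ring
  · have e : c * (‖θ‖ ^ 2 / 2) = t * ‖θ‖ / 2 := by rw [hc]; field_simp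
    have e2 : c * (‖θ‖ ^ 2 / 2) ≤ c * ∑ j ∈ s, θ j ^ 2 := by gcongr
    rw [seqQuad_add, hinner, add_sub_cancel_left]
    refine le_trans ?_ (le_abs_self _)
    nlinarith [sq_nonneg ‖h‖]

lemma ofReal_mul_add_le_of_le {R : ℝ≥0∞} {a b c : ℝ} (h₁ : ENNReal.ofReal (2 * c * a) ≤ R)
    (h₂ : ENNReal.ofReal (2 * c * b) ≤ R) : ENNReal.ofReal (c * (a + b)) ≤ R := by
  rcases le_total (c * a) (c * b) with h | h
  · exact (ENNReal.ofReal_le_ofReal (by linarith)).trans h₂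
  · exact (ENNReal.ofReal_le_ofReal (by linarith)).trans h₁

theorem seqMinimaxRisk_lower_bound {n : ℕ} (hn : 1 ≤ n) (θ : SeqSpace) {r : ℝ} (hr : 0 ≤ r) :
    ENNReal.ofReal (1 / 128 * (r ^ 2 + ‖θ‖ ^ 2 * min r (1 / (n : ℝ)))) ≤ seqMinimaxRisk n θ r := by
  have h0 : 0 ≤ ‖θ‖ ^ 2 * min r (1 / (n : ℝ)) :=
    mul_nonneg (sq_nonneg _) (le_min hr (by positivity))
  refine ofReal_mul_add_le_of_le ?_ ?_
  · exact (ENNReal.ofReal_le_ofReal (by linarith)).trans (seqMinimaxRisk_ge_radius hn θ hr)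
  · exact (ENNReal.ofReal_le_ofReal (by linarith)).trans (seqMinimaxRisk_ge_linear hn θ hr)

/-! ### Oscillating functions -/

section Oscillation

variable {d : ℕ}

/-- The oscillating function `x ↦ sin (2π k x_i)`. -/
def osc (i : Fin d) (k : ℕ) (x : Fin d → ℝ) : ℝ := Real.sin (2 * Real.pi * k * x i)

lemma measurable_osc (i : Fin d) (k : ℕ) : Measurable (osc i k) := by
  unfold osc
  fun_prop

lemma abs_osc_le_one (i : Fin d) (k : ℕ) (x : Fin d → ℝ) : |osc i k x| ≤ 1 :=
  Real.abs_sin_le_one _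

lemma osc_neg (i : Fin d) (k : ℕ) (x : Fin d → ℝ) : osc i k (-x) = -osc i k x := by
  simp [osc]

lemma osc_sq (i : Fin d) (k : ℕ) (x : Fin d → ℝ) :
    osc i k x ^ 2 = 1 / 2 - Real.cos (2 * Real.pi * (2 * k : ℕ) * x i) / 2 := by
  rw [osc, Real.sin_sq_eq_half_sub]
  congr 3
  push_cast
  ring

/-- Riemann–Lebesgue along the frequencies `k` times the `i`-th coordinate functional, which leave
every compact set; cosine and sine are the real and (negated) imaginary parts. -/
lemma tendsto_integral_mul_cos_sin (i : Fin d) {ψ : (Fin d → ℝ) → ℝ} (hψ : Integrable ψ) :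
    Tendsto (fun k : ℕ => ∫ x, ψ x * Real.cos (2 * Real.pi * k * x i)) atTop (𝓝 0) ∧
    Tendsto (fun k : ℕ => ∫ x, ψ x * Real.sin (2 * Real.pi * k * x i)) atTop (𝓝 0) := by
  set p : StrongDual ℝ (Fin d → ℝ) := ContinuousLinearMap.proj i with hp
  have hp0 : p ≠ 0 := fun h => by
    have := congrArg (fun q : StrongDual ℝ (Fin d → ℝ) => q 1) h
    simp [hp] at this
  have hw : Tendsto (fun k : ℕ => (k : ℝ) • p) atTop (cocompact _) := by
    rw [← Metric.cobounded_eq_cocompact, ← tendsto_norm_atTop_iff_cobounded]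
    simp only [norm_smul, Real.norm_natCast]
    exact tendsto_natCast_atTop_atTop.atTop_mul_const (norm_pos_iff.2 hp0)
  have hF := (tendsto_integral_exp_smul_cocompact (fun x => (ψ x : ℂ))
    (volume : Measure (Fin d → ℝ))).comp hw
  have hi : ∀ k : ℕ, Integrable
      (fun x => Real.fourierChar (-((k : ℝ) • p) x) • (ψ x : ℂ)) := by
    intro k
    have hc : Integrable fun x => (ψ x : ℂ) := hψ.ofReal
    refine hc.mono ?_ (ae_of_all _ fun x => by rw [Circle.norm_smul])
    refine AEStronglyMeasurable.smul ?_ hc.aestronglyMeasurable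
    exact (continuous_induced_dom.comp
      (Real.continuous_fourierChar.comp ((k : ℝ) • p).continuous.neg)).aestronglyMeasurable
  have hval : ∀ (k : ℕ) (x : Fin d → ℝ), Real.fourierChar (-((k : ℝ) • p) x) • (ψ x : ℂ) =
      Complex.exp ((-(2 * Real.pi * k * x i) : ℝ) * Complex.I) * (ψ x : ℂ) := by
    intro k x
    rw [Circle.smul_def, Real.fourierChar_apply, smul_eq_mul]
    congr 3
    simp [hp]
    ring
  constructor
  · have := (Complex.continuous_re.tendsto 0).comp hF
    refine this.congr fun k => ?_
    simp only [Function.comp_apply]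
    rw [← RCLike.re_eq_complex_re, ← integral_re (hi k)]
    refine integral_congr_ae (ae_of_all _ fun x => ?_)
    simp only [RCLike.re_eq_complex_re]
    rw [hval, Complex.re_mul_ofReal, Complex.exp_ofReal_mul_I_re, Real.cos_neg, mul_comm]
  · have := ((Complex.continuous_im.tendsto 0).comp hF).neg
    simp only [Complex.zero_im, neg_zero] at this
    refine this.congr fun k => ?_
    simp only [Function.comp_apply]
    rw [← RCLike.im_eq_complex_im, ← integral_im (hi k), ← integral_neg]
    refine integral_congr_ae (ae_of_all _ fun x => ?_)
    simp only [RCLike.im_eq_complex_im]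
    rw [hval, Complex.im_mul_ofReal, Complex.exp_ofReal_mul_I_im, Real.sin_neg]
    ring

lemma tendsto_integral_mul_osc (i : Fin d) {ψ : (Fin d → ℝ) → ℝ} (hψ : Integrable ψ) :
    Tendsto (fun k => ∫ x, ψ x * osc i k x) atTop (𝓝 0) :=
  (tendsto_integral_mul_cos_sin i hψ).2

lemma integrable_mul_osc (i : Fin d) (k : ℕ) {ψ : (Fin d → ℝ) → ℝ} (hψ : Integrable ψ) :
    Integrable fun x => ψ x * osc i k x :=
  hψ.mul_bdd (c := 1) (measurable_osc i k).aestronglyMeasurable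
    (ae_of_all _ (abs_osc_le_one i k))

lemma tendsto_integral_mul_osc_sq (i : Fin d) {ψ : (Fin d → ℝ) → ℝ} (hψ : Integrable ψ) :
    Tendsto (fun k => ∫ x, ψ x * osc i k x ^ 2) atTop (𝓝 ((∫ x, ψ x) / 2)) := by
  -- Since `sin² = (1 - cos 2·) / 2`, the cosine is needed along even frequencies only.
  have h := (tendsto_integral_mul_cos_sin i hψ).1.comp
    (tendsto_id.const_mul_atTop' (r := 2) (by norm_num))
  have h2 := (h.div_const 2).const_sub ((∫ x, ψ x) / 2)
  simp only [zero_div, sub_zero] at h2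
  refine h2.congr fun k => ?_
  have hc : Integrable fun x => ψ x * Real.cos (2 * Real.pi * (2 * k : ℕ) * x i) :=
    hψ.mul_bdd (c := 1)
      (Real.measurable_cos.comp (by fun_prop)).aestronglyMeasurable (ae_of_all _ fun x => Real.abs_cos_le_one _)
  simp only [Function.comp_apply, id]
  rw [← integral_div, ← integral_div, ← integral_sub (hψ.div_const 2) (hc.div_const 2)]
  refine integral_congr_ae (ae_of_all _ fun x => ?_)
  simp only [osc_sq]
  ring

/-- Oscillating perturbations of two functions contribute half of the product of the amplitudes. -/
lemma tendsto_integral_mul_add_osc (i : Fin d) {u₁ v₁ u₂ v₂ : (Fin d → ℝ) → ℝ}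
    (huu : Integrable fun x => u₁ x * u₂ x) (huv : Integrable fun x => u₁ x * v₂ x + v₁ x * u₂ x)
    (hvv : Integrable fun x => v₁ x * v₂ x) :
    Tendsto (fun k => ∫ x, (u₁ x + v₁ x * osc i k x) * (u₂ x + v₂ x * osc i k x)) atTop
      (𝓝 ((∫ x, u₁ x * u₂ x) + (∫ x, v₁ x * v₂ x) / 2)) := by
  have h := ((tendsto_integral_mul_osc i huv).const_add (∫ x, u₁ x * u₂ x)).add
    (tendsto_integral_mul_osc_sq i hvv)
  rw [add_zero] at h
  refine h.congr fun k => ?_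
  have hs : Integrable fun x => v₁ x * v₂ x * osc i k x ^ 2 := by
    have := integrable_mul_osc i k (integrable_mul_osc i k hvv)
    refine this.congr (ae_of_all _ fun x => ?_)
    simp only
    ring
  have h1 := integrable_mul_osc i k huv
  have h2 : Integrable fun x => u₁ x * u₂ x + (u₁ x * v₂ x + v₁ x * u₂ x) * osc i k x := huu.add h1
  rw [← integral_add huu h1, ← integral_add h2 hs]
  exact integral_congr_ae (ae_of_all _ fun x => by simp only; ring)

end Oscillation

/-! ### Densities -/

namespace IsBoundedDensity

variable {d : ℕ} {M : ℝ} {f : (Fin d → ℝ) → ℝ}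

lemma integrable (hf : IsBoundedDensity M f) : Integrable f := by
  by_contra h
  have := hf.integral_eq_one
  rw [integral_undef h] at this
  norm_num at this

lemma ae_norm_le (hf : IsBoundedDensity M f) : ∀ᵐ x, ‖f x‖ ≤ M := by
  filter_upwards [hf.le_bound] with x hx
  rwa [Real.norm_of_nonneg (hf.nonneg x)]

lemma integrable_mul (hf : IsBoundedDensity M f) {g : (Fin d → ℝ) → ℝ} (hg : Integrable g) :
    Integrable fun x => g x * f x :=
  hg.mul_bdd hf.measurable.aestronglyMeasurable hf.ae_norm_le

lemma integrable_sq (hf : IsBoundedDensity M f) : Integrable fun x => f x ^ 2 := by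
  simpa only [sq] using hf.integrable_mul hf.integrable

lemma integrable_cube (hf : IsBoundedDensity M f) : Integrable fun x => f x ^ 3 := by
  simpa only [pow_succ, pow_zero, one_mul] using
    hf.integrable_mul (hf.integrable_mul hf.integrable)

lemma integral_sq_le (hf : IsBoundedDensity M f) : ∫ x, f x ^ 2 ≤ M := by
  calc ∫ x, f x ^ 2 ≤ ∫ x, M * f x := by
        refine integral_mono_ae hf.integrable_sq (hf.integrable.const_mul M) ?_
        filter_upwards [hf.le_bound] with x hx
        rw [sq]
        exact mul_le_mul_of_nonneg_right hx (hf.nonneg x)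
    _ = M := by rw [integral_const_mul, hf.integral_eq_one, mul_one]

lemma isProbabilityMeasure (hf : IsBoundedDensity M f) :
    IsProbabilityMeasure (volume.withDensity fun x => ENNReal.ofReal (f x)) := by
  refine ⟨?_⟩
  rw [withDensity_apply _ MeasurableSet.univ, Measure.restrict_univ,
    ← ofReal_integral_eq_lintegral_ofReal hf.integrable (ae_of_all _ hf.nonneg),
    hf.integral_eq_one, ENNReal.ofReal_one]

lemma isProbabilityMeasure_densLaw (hf : IsBoundedDensity M f) (n : ℕ) :
    IsProbabilityMeasure (densLaw n f) := by
  have := hf.isProbabilityMeasure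
  unfold densLaw
  infer_instance

lemma self_mem_densClass (hf : IsBoundedDensity M f) {r : ℝ} (hr : 0 ≤ r) :
    f ∈ densClass M f r := ⟨hf, by simpa using hr⟩

end IsBoundedDensity

/-! ### The contribution of the radius -/

section Box

variable {d : ℕ}

/-- A box, symmetric about the origin, of volume `4 / M`. -/
def symmBox (i : Fin d) (M : ℝ) : Set (Fin d → ℝ) :=
  Set.Icc (-Function.update (fun _ => 1 / 2) i (2 / M)) (Function.update (fun _ => 1 / 2) i (2 / M))

lemma neg_mem_symmBox (i : Fin d) (M : ℝ) (x : Fin d → ℝ) :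
    -x ∈ symmBox i M ↔ x ∈ symmBox i M := by
  simp only [symmBox, Set.mem_Icc]
  rw [neg_le_neg_iff, neg_le, and_comm]

lemma measurableSet_symmBox (i : Fin d) (M : ℝ) : MeasurableSet (symmBox i M) := measurableSet_Icc

lemma volume_symmBox (i : Fin d) (M : ℝ) : volume (symmBox i M) = ENNReal.ofReal (4 / M) := by
  rw [symmBox, Real.volume_Icc_pi, ← Finset.mul_prod_erase _ _ (Finset.mem_univ i),
    Finset.prod_eq_one]
  · simp only [Pi.neg_apply, Function.update_self, mul_one]
    congr 1
    ring
  · intro j hj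
    simp only [Pi.neg_apply, Function.update_of_ne (Finset.ne_of_mem_erase hj)]
    norm_num

/-- The uniform density on `symmBox i M`. -/
def boxDensity (i : Fin d) (M : ℝ) : (Fin d → ℝ) → ℝ := (symmBox i M).indicator fun _ => M / 4

lemma measurable_boxDensity (i : Fin d) (M : ℝ) : Measurable (boxDensity i M) :=
  measurable_const.indicator (measurableSet_symmBox i M)

lemma boxDensity_nonneg (i : Fin d) {M : ℝ} (hM : 0 < M) (x : Fin d → ℝ) :
    0 ≤ boxDensity i M x := Set.indicator_nonneg (fun _ _ => by positivity) x

lemma boxDensity_le (i : Fin d) {M : ℝ} (hM : 0 < M) (x : Fin d → ℝ) :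
    boxDensity i M x ≤ M / 4 := Set.indicator_le_self' (fun _ _ => by positivity) x

lemma integrable_boxDensity (i : Fin d) (M : ℝ) : Integrable (boxDensity i M) := by
  refine (integrable_indicator_iff (measurableSet_symmBox i M)).2 (integrableOn_const ?_)
  rw [volume_symmBox]
  exact ENNReal.ofReal_ne_top

lemma integral_boxDensity (i : Fin d) {M : ℝ} (hM : 0 < M) : ∫ x, boxDensity i M x = 1 := by
  rw [boxDensity, integral_indicator_const _ (measurableSet_symmBox i M), measureReal_def,
    volume_symmBox, ENNReal.toReal_ofReal (by positivity), smul_eq_mul]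
  field_simp

lemma boxDensity_sq (i : Fin d) (M : ℝ) (x : Fin d → ℝ) :
    boxDensity i M x ^ 2 = M / 4 * boxDensity i M x := by
  by_cases hx : x ∈ symmBox i M <;> simp [boxDensity, hx, sq]

/-- Odd integrand on a symmetric box. The integral vanishes exactly, not just in the limit, so the
tilted function keeps total mass 1. -/
lemma integral_boxDensity_mul_osc (i : Fin d) (M : ℝ) (k : ℕ) :
    ∫ x, boxDensity i M x * osc i k x = 0 := by
  have h := integral_neg_eq_self (fun x => boxDensity i M x * osc i k x) volume
  have e : ∀ x, boxDensity i M (-x) * osc i k (-x) = -(boxDensity i M x * osc i k x) := fun x => by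
    rw [osc_neg]
    by_cases hx : x ∈ symmBox i M
    · simp [boxDensity, hx, neg_mem_symmBox]
    · simp [boxDensity, hx, neg_mem_symmBox]
  simp only [e, integral_neg] at h
  linarith

end Box

section Radius

variable {d : ℕ} {M : ℝ} {fhat : (Fin d → ℝ) → ℝ}

/-- The pilot density, with mass `a` moved to a box, on which it is tilted by `ρ`. -/
def contaminated (fhat : (Fin d → ℝ) → ℝ) (i : Fin d) (M a : ℝ) (ρ : (Fin d → ℝ) → ℝ)
    (x : Fin d → ℝ) : ℝ :=
  ((1 - a) * fhat x + a * boxDensity i M x) + a * boxDensity i M x * ρ x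

/-- Tilting the pilot itself would not do: its `∫ fhat ^ 2` may be arbitrarily small, and the
constant must not depend on it. The box carries a fixed height `M / 4`; even doubled by the tilt it
stays below `M`, so the mixture does too. The squared distance is at most `a ^ 2 * (2 * M + 2 * M)`.
-/
lemma contaminated_mem_densClass (hM : 0 < M) (hf : IsBoundedDensity M fhat) (i : Fin d) {a r : ℝ}
    (ha0 : 0 ≤ a) (ha1 : a ≤ 1) (har : 4 * M * a ^ 2 ≤ r) {ρ : (Fin d → ℝ) → ℝ}
    (hρ : Measurable ρ) (hρb : ∀ x, |ρ x| ≤ 1) (hρ0 : ∫ x, boxDensity i M x * ρ x = 0) :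
    contaminated fhat i M a ρ ∈ densClass M fhat r := by
  have hg := measurable_boxDensity i M
  have ig := integrable_boxDensity i M
  have igρ : Integrable fun x => boxDensity i M x * ρ x :=
    ig.mul_bdd (c := 1) hρ.aestronglyMeasurable (ae_of_all _ hρb)
  have igs : Integrable fun x => boxDensity i M x ^ 2 := by
    simp only [boxDensity_sq]; exact ig.const_mul _
  refine ⟨⟨?_, fun x => ?_, ?_, ?_⟩, ?_⟩
  · exact ((hf.measurable.const_mul _).add (hg.const_mul _)).add ((hg.const_mul _).mul hρ)
  · have h1 := hf.nonneg x
    have h2 := boxDensity_nonneg i hM x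
    have h3 := neg_le_of_abs_le (hρb x)
    have h4 : 0 ≤ a * boxDensity i M x := by positivity
    unfold contaminated
    nlinarith [mul_nonneg (sub_nonneg.2 ha1) h1]
  · have e : ∀ x, contaminated fhat i M a ρ x =
        ((1 - a) * fhat x + a * boxDensity i M x) + a * (boxDensity i M x * ρ x) := fun x => by
      unfold contaminated; ring
    have i1 : Integrable fun x => (1 - a) * fhat x + a * boxDensity i M x :=
      (hf.integrable.const_mul _).add (ig.const_mul _)
    simp only [e]
    rw [integral_add i1 (igρ.const_mul _), integral_add (hf.integrable.const_mul _)
      (ig.const_mul _), integral_const_mul, integral_const_mul, integral_const_mul, hρ0,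
      hf.integral_eq_one, integral_boxDensity i hM]
    ring
  · filter_upwards [hf.le_bound] with x hx
    have h2 := boxDensity_nonneg i hM x
    have h3 := le_of_abs_le (hρb x)
    have h4 : 0 ≤ a * boxDensity i M x := by positivity
    have h5 := boxDensity_le i hM x
    unfold contaminated
    nlinarith [mul_le_mul_of_nonneg_left hx (sub_nonneg.2 ha1),
      mul_le_mul_of_nonneg_left h5 ha0, mul_nonneg ha0 hM.le]
  · calc ∫ x, (contaminated fhat i M a ρ x - fhat x) ^ 2
        ≤ ∫ x, a ^ 2 * (8 * boxDensity i M x ^ 2 + 2 * fhat x ^ 2) := by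
          refine integral_mono_of_nonneg (ae_of_all _ fun x => sq_nonneg _)
            (((igs.const_mul _).add (hf.integrable_sq.const_mul _)).const_mul _)
            (ae_of_all _ fun x => ?_)
          have e : contaminated fhat i M a ρ x - fhat x =
              a * (boxDensity i M x * (1 + ρ x) - fhat x) := by unfold contaminated; ring
          simp only [e, mul_pow]
          refine mul_le_mul_of_nonneg_left ?_ (sq_nonneg a)
          have h1 : (1 + ρ x) ^ 2 ≤ 4 := by
            have := abs_le.1 (hρb x)
            nlinarith
          have h2 : (boxDensity i M x * (1 + ρ x)) ^ 2 ≤ boxDensity i M x ^ 2 * 4 := by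
            rw [mul_pow]
            exact mul_le_mul_of_nonneg_left h1 (sq_nonneg _)
          nlinarith [sq_nonneg (boxDensity i M x * (1 + ρ x) + fhat x)]
      _ = a ^ 2 * (8 * (M / 4) + 2 * ∫ x, fhat x ^ 2) := by
          rw [integral_const_mul, integral_add (igs.const_mul _) (hf.integrable_sq.const_mul _),
            integral_const_mul, integral_const_mul]
          simp only [boxDensity_sq]
          rw [integral_const_mul, integral_boxDensity i hM, mul_one]
      _ ≤ a ^ 2 * (8 * (M / 4) + 2 * M) := by gcongr; exact hf.integral_sq_le
      _ ≤ r := by linarith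

lemma densMinimaxRisk_ge_radius (hM : 0 < M) (hf : IsBoundedDensity M fhat) (hd : 1 ≤ d) (n : ℕ)
    {a r : ℝ} (ha0 : 0 ≤ a) (ha1 : a ≤ 1) (har : 4 * M * a ^ 2 ≤ r) :
    ENNReal.ofReal ((a ^ 2 * M / 8) ^ 2 / 64) ≤ densMinimaxRisk n M fhat r := by
  set i : Fin d := ⟨0, hd⟩ with hi
  have hg := measurable_boxDensity i M
  have ig := integrable_boxDensity i M
  have m0 : contaminated fhat i M a 0 ∈ densClass M fhat r :=
    contaminated_mem_densClass hM hf i ha0 ha1 har measurable_zero (by simp) (by simp)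
  have mk : ∀ k, contaminated fhat i M a (osc i k) ∈ densClass M fhat r := fun k =>
    contaminated_mem_densClass hM hf i ha0 ha1 har (measurable_osc i k) (abs_osc_le_one i k)
      (integral_boxDensity_mul_osc i M k)
  have := m0.1.isProbabilityMeasure
  have := fun k => (mk k).1.isProbabilityMeasure
  have := m0.1.isProbabilityMeasure_densLaw n
  have := fun k => (mk k).1.isProbabilityMeasure_densLaw n
  set u : (Fin d → ℝ) → ℝ := fun x => (1 - a) * fhat x + a * boxDensity i M x with hu
  set v : (Fin d → ℝ) → ℝ := fun x => a * boxDensity i M x with hv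
  have e0 : contaminated fhat i M a 0 = u := by ext x; simp [contaminated, hu]
  have ek : ∀ k, contaminated fhat i M a (osc i k) = fun x => u x + v x * osc i k x := fun k => rfl
  have iu : Integrable u := (hf.integrable.const_mul _).add (ig.const_mul _)
  have iv : Integrable v := ig.const_mul _
  have mu : Measurable u := (hf.measurable.const_mul _).add (hg.const_mul _)
  have mv : Measurable v := hg.const_mul _
  have v0 : ∀ x, 0 ≤ v x := fun x => mul_nonneg ha0 (boxDensity_nonneg i hM x)
  have u0 : IsBoundedDensity M u := e0 ▸ m0.1
  have hvb : ∀ᵐ x, ‖v x‖ ≤ M := ae_of_all _ fun x => by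
    rw [Real.norm_of_nonneg (v0 x)]
    have := mul_le_mul ha1 (boxDensity_le i hM x) (boxDensity_nonneg i hM x) zero_le_one
    simp only [hv]; linarith
  refine le_minimaxRisk_of_setwiseTendsto m0 mk ?_ ?_
  -- As `osc ≤ 1` and `v ≥ 0`, the density `u + v` dominates all alternatives.
  · have hfin : IsFiniteMeasure (volume.withDensity fun x => ENNReal.ofReal (u x + v x)) := by
      refine isFiniteMeasure_withDensity_ofReal (iu.add iv).2
    refine SetwiseTendsto.pi (η := volume.withDensity fun x => ENNReal.ofReal (u x + v x)) ?_ ?_ n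
    · intro k
      refine withDensity_mono (ae_of_all _ fun x => ENNReal.ofReal_le_ofReal ?_)
      rw [ek]
      have := mul_le_mul_of_nonneg_left (le_of_abs_le (abs_osc_le_one i k x)) (v0 x)
      simp only
      linarith
    · rw [e0]
      simp only [ek]
      exact setwiseTendsto_withDensity (measurable_osc i) (abs_osc_le_one i)
        (fun ψ hψ => tendsto_integral_mul_osc i hψ) mu mv iu iv u0.nonneg
        fun k x => (ek k ▸ (mk k).1.nonneg x :)
  · have ivv : Integrable fun x => v x * v x := iv.mul_bdd mv.aestronglyMeasurable hvb
    have iuv : Integrable fun x => u x * v x := iu.mul_bdd mv.aestronglyMeasurable hvb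
    have ivu : Integrable fun x => v x * u x := u0.integrable_mul iv
    have h := tendsto_integral_mul_add_osc i (u0.integrable_mul u0.integrable) (iuv.add ivu) ivv
    have evv : ∫ x, v x * v x = a ^ 2 * M / 4 := by
      have : ∀ x, v x * v x = a ^ 2 * (M / 4) * boxDensity i M x := fun x => by
        simp only [hv]
        rw [mul_mul_mul_comm, ← sq, ← sq, boxDensity_sq, mul_assoc]
      simp only [this]
      rw [integral_const_mul, integral_boxDensity i hM]
      ring
    rw [evv] at h
    simp only [densQuad, e0, ek, sq (u _), sq (u _ + _)]
    convert h using 2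
    ring

end Radius

/-! ### The contribution of the linear term for densities -/

section DensityLinear

variable {d : ℕ} {M : ℝ} {f : (Fin d → ℝ) → ℝ}

lemma one_add_pow_le_four {x : ℝ} {n : ℕ} (hx : 0 ≤ x) (h : n * x ≤ 1) :
    ENNReal.ofReal (1 + x) ^ n ≤ 4 := by
  rw [← ENNReal.ofReal_pow (by linarith), show (4 : ℝ≥0∞) = ENNReal.ofReal 4 by simp]
  refine ENNReal.ofReal_le_ofReal ?_
  calc (1 + x) ^ n ≤ Real.exp x ^ n := by
        gcongr
        linarith [Real.add_one_le_exp x]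
    _ = Real.exp (n * x) := by rw [← Real.exp_nat_mul]
    _ ≤ 4 := by linarith [Real.exp_le_exp.2 h, Real.exp_one_lt_d9]

/-- The variance of `f(X)` for `X` with density `f`. -/
def densVar (f : (Fin d → ℝ) → ℝ) : ℝ := (∫ x, f x ^ 3) - (∫ x, f x ^ 2) ^ 2

lemma integral_cube_sub_eq_densVar (hf : IsBoundedDensity M f) (q : ℝ) (hq : q = densQuad f) :
    Integrable (fun x => f x * (f x - q) ^ 2) ∧ ∫ x, f x * (f x - q) ^ 2 = densVar f := by
  have e : ∀ x, f x * (f x - q) ^ 2 = f x ^ 3 - (2 * q * f x ^ 2 - q ^ 2 * f x) := fun x => by ring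
  have i1 : Integrable fun x => 2 * q * f x ^ 2 - q ^ 2 * f x :=
    (hf.integrable_sq.const_mul _).sub (hf.integrable.const_mul _)
  simp only [e]
  refine ⟨hf.integrable_cube.sub i1, ?_⟩
  rw [integral_sub hf.integrable_cube i1, integral_sub (hf.integrable_sq.const_mul _)
    (hf.integrable.const_mul _), integral_const_mul, integral_const_mul, hf.integral_eq_one]
  change _ = (∫ x, f x ^ 3) - densQuad f ^ 2
  rw [show ∫ x, f x ^ 2 = q from hq.symm, ← hq]
  ring

lemma densVar_nonneg (hf : IsBoundedDensity M f) : 0 ≤ densVar f := by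
  rw [← (integral_cube_sub_eq_densVar hf _ rfl).2]
  exact integral_nonneg fun x => mul_nonneg (hf.nonneg x) (sq_nonneg _)

/-- The density `f` moved against its influence function; the positive part only matters on a null
set. -/
def flattened (f : (Fin d → ℝ) → ℝ) (t : ℝ) (x : Fin d → ℝ) : ℝ :=
  f x * max 0 (1 - t * (f x - densQuad f))

lemma flattened_ae_eq (hf : IsBoundedDensity M f) {t : ℝ} (ht : 0 ≤ t) (htM : t * M ≤ 1) :
    ∀ᵐ x, flattened f t x = f x * (1 - t * (f x - densQuad f)) := by
  filter_upwards [hf.le_bound] with x hx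
  have hq : 0 ≤ densQuad f := integral_nonneg fun x => sq_nonneg _
  rw [flattened, max_eq_right]
  nlinarith [mul_le_mul_of_nonneg_left hx ht, mul_nonneg ht hq]

lemma measurable_flattened (hf : IsBoundedDensity M f) (t : ℝ) : Measurable (flattened f t) := by
  have := hf.measurable
  unfold flattened
  fun_prop

lemma integral_sq_mul_sub_sq_le (hf : IsBoundedDensity M f) :
    Integrable (fun x => f x ^ 2 * (f x - densQuad f) ^ 2) ∧
      ∫ x, f x ^ 2 * (f x - densQuad f) ^ 2 ≤ M * densVar f := by
  obtain ⟨i1, e1⟩ := integral_cube_sub_eq_densVar hf _ rfl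
  have i2 : Integrable fun x => f x ^ 2 * (f x - densQuad f) ^ 2 := by
    refine (hf.integrable_mul i1).congr (ae_of_all _ fun x => ?_)
    simp only
    ring
  refine ⟨i2, ?_⟩
  rw [← e1, ← integral_const_mul]
  refine integral_mono_ae i2 (i1.const_mul M) ?_
  filter_upwards [hf.le_bound] with x hx
  rw [sq, mul_assoc]
  exact mul_le_mul_of_nonneg_right hx (mul_nonneg (hf.nonneg x) (sq_nonneg _))

/-- Mass is kept because `f - ∫ f ^ 2` has mean zero under `f`. The negative sign of the shift
preserves the bound `M`: values above `∫ f ^ 2` decrease, and those below it cannot rise past it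
since `t * f ≤ 1`. -/
lemma flattened_mem_densClass (hf : IsBoundedDensity M f) {t r : ℝ} (ht : 0 ≤ t) (htM : t * M ≤ 1)
    (hr : t ^ 2 * (M * densVar f) ≤ r) : flattened f t ∈ densClass M f r := by
  have hae := flattened_ae_eq hf ht htM
  have hq : 0 ≤ densQuad f := integral_nonneg fun x => sq_nonneg _
  have hqM : densQuad f ≤ M := hf.integral_sq_le
  have hM : 0 ≤ M := hq.trans hqM
  refine ⟨⟨measurable_flattened hf t, fun x => mul_nonneg (hf.nonneg x) (le_max_left _ _), ?_, ?_⟩,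
    ?_⟩
  · rw [integral_congr_ae hae]
    have e : ∀ x, f x * (1 - t * (f x - densQuad f)) =
        (1 + t * densQuad f) * f x - t * f x ^ 2 := fun x => by ring
    simp only [e]
    rw [integral_sub (hf.integrable.const_mul _) (hf.integrable_sq.const_mul _),
      integral_const_mul, integral_const_mul, hf.integral_eq_one]
    rw [show ∫ x, f x ^ 2 = densQuad f from rfl]
    ring
  · filter_upwards [hae, hf.le_bound] with x hx hxM
    rw [hx]
    have h0 := hf.nonneg x
    rcases le_total (densQuad f) (f x) with h | h
    · nlinarith [mul_nonneg (mul_nonneg h0 ht) (sub_nonneg.2 h)]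
    · have h1 : f x * t ≤ 1 := by nlinarith
      nlinarith [mul_le_mul_of_nonneg_right h1 (sub_nonneg.2 h)]
  · have e : ∀ᵐ x, (flattened f t x - f x) ^ 2 = t ^ 2 * (f x ^ 2 * (f x - densQuad f) ^ 2) := by
      filter_upwards [hae] with x hx
      rw [hx]
      ring
    rw [integral_congr_ae e, integral_const_mul]
    exact (mul_le_mul_of_nonneg_left (integral_sq_mul_sub_sq_le hf).2 (sq_nonneg t)).trans hr

/-- The functional drops by `2tV` minus a quadratic term, with `V = densVar f`; that term is at most
`t²MV ≤ tV`, so half of the linear drop remains. -/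
lemma densQuad_flattened (hf : IsBoundedDensity M f) {t : ℝ} (ht : 0 ≤ t) (htM : t * M ≤ 1) :
    t * densVar f ≤ |densQuad (flattened f t) - densQuad f| := by
  obtain ⟨i2, h2⟩ := integral_sq_mul_sub_sq_le hf
  have e : ∀ᵐ x, flattened f t x ^ 2 = f x ^ 2 -
      (2 * t * (f x ^ 3 - densQuad f * f x ^ 2) - t ^ 2 * (f x ^ 2 * (f x - densQuad f) ^ 2)) := by
    filter_upwards [flattened_ae_eq hf ht htM] with x hx
    rw [hx]
    ring
  have i3 : Integrable fun x => f x ^ 3 - densQuad f * f x ^ 2 :=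
    hf.integrable_cube.sub (hf.integrable_sq.const_mul _)
  have i4 : Integrable fun x => 2 * t * (f x ^ 3 - densQuad f * f x ^ 2) -
      t ^ 2 * (f x ^ 2 * (f x - densQuad f) ^ 2) := (i3.const_mul _).sub (i2.const_mul _)
  have eq : densQuad (flattened f t) = densQuad f - (2 * t * densVar f -
      t ^ 2 * ∫ x, f x ^ 2 * (f x - densQuad f) ^ 2) := by
    rw [densQuad, integral_congr_ae e, integral_sub hf.integrable_sq i4,
      integral_sub (i3.const_mul _) (i2.const_mul _), integral_const_mul, integral_const_mul,
      integral_sub hf.integrable_cube (hf.integrable_sq.const_mul _), integral_const_mul]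
    simp only [densVar, densQuad]
    ring
  have hV := densVar_nonneg hf
  have h3 : t ^ 2 * ∫ x, f x ^ 2 * (f x - densQuad f) ^ 2 ≤ t * densVar f := by
    calc t ^ 2 * ∫ x, f x ^ 2 * (f x - densQuad f) ^ 2 ≤ t ^ 2 * (M * densVar f) := by gcongr
      _ = (t * M) * (t * densVar f) := by ring
      _ ≤ 1 * (t * densVar f) := by gcongr
      _ = t * densVar f := one_mul _
  rw [abs_sub_comm]
  refine le_trans ?_ (le_abs_self _)
  rw [eq]
  linarith

lemma densMinimaxRisk_ge_linear (hf : IsBoundedDensity M f) (n : ℕ) {t r : ℝ} (ht : 0 ≤ t)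
    (htM : t * M ≤ 1) (hr : t ^ 2 * (M * densVar f) ≤ r) (hn : n * (t ^ 2 * densVar f) ≤ 1) :
    ENNReal.ofReal ((t * densVar f / 2) ^ 2 / 8) ≤ densMinimaxRisk n M f r := by
  have hV := densVar_nonneg hf
  have hq : 0 ≤ densQuad f := integral_nonneg fun x => sq_nonneg _
  have hM : 0 ≤ M := hq.trans hf.integral_sq_le
  have m0 : f ∈ densClass M f r :=
    hf.self_mem_densClass (le_trans (by positivity) hr)
  have m1 := flattened_mem_densClass hf ht htM hr
  have := hf.isProbabilityMeasure
  have := m1.1.isProbabilityMeasure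
  have := hf.isProbabilityMeasure_densLaw n
  have := m1.1.isProbabilityMeasure_densLaw n
  refine le_minimaxRisk_of_chiSqLE m0 m1 ?_ (by positivity) ?_
  · refine (ChiSqLE.pi (B := ENNReal.ofReal (1 + t ^ 2 * densVar f)) ?_ n).mono
      (one_add_pow_le_four (by positivity) hn)
    have mw : Measurable fun x => f x * max 0 (1 - t * (f x - densQuad f)) ^ 2 := by
      have := hf.measurable
      fun_prop
    refine ChiSqLE.of_density
      (w := fun x => ENNReal.ofReal (f x * max 0 (1 - t * (f x - densQuad f)) ^ 2))
      hf.measurable.ennreal_ofReal m1.1.measurable.ennreal_ofReal mw.ennreal_ofReal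
      (fun x => le_of_eq ?_) ?_
    · rw [← ENNReal.ofReal_mul (hf.nonneg x), ← ENNReal.ofReal_pow (m1.1.nonneg x)]
      congr 1
      rw [flattened]
      ring
    -- The cross term of `f (1 - t (f - ∫ f²))²` integrates to zero, leaving exactly `1 + t² V`.
    · obtain ⟨i1, e1⟩ := integral_cube_sub_eq_densVar hf _ rfl
      have i3 : Integrable fun x => f x ^ 2 - densQuad f * f x :=
        hf.integrable_sq.sub (hf.integrable.const_mul _)
      have i4 : Integrable fun x => f x - 2 * t * (f x ^ 2 - densQuad f * f x) :=
        hf.integrable.sub (i3.const_mul _)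
      have e : ∀ᵐ x, f x * max 0 (1 - t * (f x - densQuad f)) ^ 2 =
          (f x - 2 * t * (f x ^ 2 - densQuad f * f x)) +
            t ^ 2 * (f x * (f x - densQuad f) ^ 2) := by
        filter_upwards [hf.le_bound] with x hx
        rw [max_eq_right (by nlinarith [mul_le_mul_of_nonneg_left hx ht, mul_nonneg ht hq])]
        ring
      have iw : Integrable fun x => f x * max 0 (1 - t * (f x - densQuad f)) ^ 2 :=
        (i4.add (i1.const_mul (t ^ 2))).congr (by filter_upwards [e] with x hx using hx.symm)
      rw [← ofReal_integral_eq_lintegral_ofReal iw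
        (ae_of_all _ fun x => mul_nonneg (hf.nonneg x) (sq_nonneg _))]
      refine ENNReal.ofReal_le_ofReal (le_of_eq ?_)
      rw [integral_congr_ae e, integral_add i4 (i1.const_mul _), integral_const_mul, e1,
        integral_sub hf.integrable (i3.const_mul _), integral_const_mul,
        integral_sub hf.integrable_sq (hf.integrable.const_mul _), integral_const_mul,
        hf.integral_eq_one, show ∫ x, f x ^ 2 = densQuad f from rfl]
      ring
  · have := densQuad_flattened hf ht htM
    linarith

end DensityLinear

theorem densMinimaxRisk_lower_bound {M R : ℝ} (hM : 0 < M) (hR : 0 < R) : ∃ c : ℝ, 0 < c ∧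
    ∀ (d n : ℕ) (f : (Fin d → ℝ) → ℝ) (r : ℝ), 1 ≤ d → 1 ≤ n → IsBoundedDensity M f → 0 ≤ r →
      r ≤ R → ENNReal.ofReal (c * (r ^ 2 + densVar f * min r (1 / (n : ℝ)))) ≤
        densMinimaxRisk n M f r := by
  set κ : ℝ := min (1 / 32) (M / (8 * R)) with hκ
  have hκ0 : 0 < κ := lt_min (by norm_num) (by positivity)
  set c : ℝ := min (κ ^ 2 / 64) (1 / (32 * (1 + M) ^ 2)) with hc
  have hc0 : 0 < c := lt_min (by positivity) (by positivity)
  refine ⟨c / 2, by positivity, fun d n f r hd hn hf hr hrR => ?_⟩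
  have hrad : ENNReal.ofReal (c * r ^ 2) ≤ densMinimaxRisk n M f r := by
    have hm0 : 0 ≤ min (r / (4 * M)) 1 := le_min (by positivity) zero_le_one
    have h := densMinimaxRisk_ge_radius hM hf hd n (a := Real.sqrt (min (r / (4 * M)) 1)) (r := r)
      (Real.sqrt_nonneg _) (Real.sqrt_le_one.2 (min_le_right _ _)) (by
        rw [Real.sq_sqrt hm0]
        calc 4 * M * min (r / (4 * M)) 1 ≤ 4 * M * (r / (4 * M)) := by
              gcongr; exact min_le_left _ _
          _ = r := by field_simp)
    rw [Real.sq_sqrt hm0] at h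
    refine (ENNReal.ofReal_le_ofReal ?_).trans h
    -- The cap `a ≤ 1` on the moved mass matters only for large `r`; there `r ≤ R` supplies the
    -- constant `M / (8 * R)`.
    have h1 : κ * r ≤ min (r / (4 * M)) 1 * M / 8 := by
      rcases le_total (r / (4 * M)) 1 with h' | h'
      · rw [min_eq_left h']
        have : r / (4 * M) * M / 8 = 1 / 32 * r := by field_simp; ring
        rw [this]
        gcongr
        exact min_le_left _ _
      · rw [min_eq_right h']
        calc κ * r ≤ M / (8 * R) * R := by
              gcongr
              exact min_le_right _ _
          _ = 1 * M / 8 := by field_simp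
    calc c * r ^ 2 ≤ κ ^ 2 / 64 * r ^ 2 := by gcongr; exact min_le_left _ _
      _ = (κ * r) ^ 2 / 64 := by ring
      _ ≤ _ := by gcongr
  have hV := densVar_nonneg hf
  have hn0 : (0 : ℝ) < n := by exact_mod_cast hn
  set m := min r (1 / (n : ℝ)) with hm
  have hm0 : 0 ≤ m := le_min hr (by positivity)
  have hmr : m ≤ r := min_le_left _ _
  have hlin : ENNReal.ofReal (c * (densVar f * m)) ≤ densMinimaxRisk n M f r := by
    -- If the variance is at most `m`, then `densVar f * m ≤ r ^ 2` and the radius term suffices.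
    -- Otherwise `m / densVar f < 1`, and dividing its root by `1 + M` meets all three constraints
    -- on `t`.
    rcases le_or_gt (densVar f) m with hVm | hVm
    · refine (ENNReal.ofReal_le_ofReal ?_).trans hrad
      have : densVar f * m ≤ r ^ 2 := by
        rw [sq]
        exact mul_le_mul (hVm.trans hmr) hmr hm0 hr
      gcongr
    · have hV0 : 0 < densVar f := hm0.trans_lt hVm
      set t := Real.sqrt (m / densVar f) / (1 + M) with ht
      have ht0 : 0 ≤ t := by positivity
      have ht2 : t ^ 2 = m / densVar f / (1 + M) ^ 2 := by
        rw [ht, div_pow, Real.sq_sqrt (by positivity)]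
      have ht2V : t ^ 2 * densVar f = m / (1 + M) ^ 2 := by rw [ht2]; field_simp
      have h1 : Real.sqrt (m / densVar f) ≤ 1 :=
        Real.sqrt_le_one.2 ((div_le_one hV0).2 hVm.le)
      have hsq1 : (1 : ℝ) ≤ (1 + M) ^ 2 := by nlinarith
      have h := densMinimaxRisk_ge_linear hf n (t := t) (r := r) ht0 (by
          rw [ht, div_mul_eq_mul_div, div_le_one (by positivity)]
          nlinarith) (by
          rw [mul_left_comm, ht2V, ← mul_div_assoc, div_le_iff₀ (by positivity)]
          nlinarith [mul_nonneg hM.le hm0, mul_nonneg hr hM.le]) (by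
          rw [ht2V]
          calc n * (m / (1 + M) ^ 2) ≤ n * (1 / (n : ℝ)) :=
                mul_le_mul_of_nonneg_left ((div_le_self hm0 hsq1).trans (min_le_right _ _)) hn0.le
            _ = 1 := by field_simp)
      refine (ENNReal.ofReal_le_ofReal ?_).trans h
      calc c * (densVar f * m) ≤ 1 / (32 * (1 + M) ^ 2) * (densVar f * m) := by
            gcongr; exact min_le_right _ _
        _ = t ^ 2 * densVar f * densVar f / 32 := by rw [ht2V]; field_simp
        _ = _ := by ring
  refine ofReal_mul_add_le_of_le ?_ ?_
  · rwa [mul_div_cancel₀ _ two_ne_zero]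
  · rwa [mul_div_cancel₀ _ two_ne_zero]

/-! ### Lower bound for the expected conditional covariance -/

section Cube

variable {d : ℕ}

/-- The uniform density on the unit cube. -/
def cubeDensity (d : ℕ) : (Fin d → ℝ) → ℝ := (cube d).indicator 1

lemma measurable_cubeDensity : Measurable (cubeDensity d) :=
  measurable_one.indicator measurableSet_Icc

lemma cubeDensity_of_mem {x : Fin d → ℝ} (hx : x ∈ cube d) : cubeDensity d x = 1 :=
  Set.indicator_of_mem hx _

lemma cubeDensity_of_notMem {x : Fin d → ℝ} (hx : x ∉ cube d) : cubeDensity d x = 0 :=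
  Set.indicator_of_notMem hx _

lemma cubeDensity_nonneg (x : Fin d → ℝ) : 0 ≤ cubeDensity d x :=
  Set.indicator_nonneg (fun _ _ => zero_le_one) x

lemma volume_cube : volume (cube d) = 1 := by
  simp [Real.volume_Icc_pi]

lemma integrable_cubeDensity : Integrable (cubeDensity d) := by
  refine (integrable_indicator_iff measurableSet_Icc).2 (integrableOn_const ?_)
  rw [volume_cube]
  exact ENNReal.one_ne_top

lemma integral_cubeDensity : ∫ x, cubeDensity d x = 1 := by
  rw [cubeDensity, integral_indicator_one measurableSet_Icc, measureReal_def, volume_cube,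
    ENNReal.toReal_one]

lemma lintegral_cubeDensity : ∫⁻ x, ENNReal.ofReal (cubeDensity d x) = 1 := by
  rw [← ofReal_integral_eq_lintegral_ofReal integrable_cubeDensity
    (ae_of_all _ cubeDensity_nonneg), integral_cubeDensity, ENNReal.ofReal_one]

lemma integrable_mul_cubeDensity {h : (Fin d → ℝ) → ℝ} (hm : Measurable h) {C : ℝ}
    (hC : ∀ x ∈ cube d, |h x| ≤ C) : Integrable fun x => h x * cubeDensity d x := by
  refine (integrable_cubeDensity.const_mul C).mono
    (hm.mul measurable_cubeDensity).aestronglyMeasurable (ae_of_all _ fun x => ?_)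
  by_cases hx : x ∈ cube d
  · rw [cubeDensity_of_mem hx, mul_one, mul_one, Real.norm_eq_abs]
    exact (hC x hx).trans (le_abs_self C)
  · simp [cubeDensity_of_notMem hx]

end Cube

/-! ### The law of a single observation `(X, A, Y)`. -/

section Observation

variable {d : ℕ}

/-- The reference measure for a single observation. -/
abbrev obsRef (d : ℕ) : Measure ((Fin d → ℝ) × Bool × Bool) :=
  volume.prod (Measure.count.prod Measure.count)

lemma lintegral_obsRef {F : (Fin d → ℝ) × Bool × Bool → ℝ≥0∞} (hF : Measurable F) :
    ∫⁻ z, F z ∂(obsRef d) = ∫⁻ x, ((F (x, true, true) + F (x, true, false)) +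
      (F (x, false, true) + F (x, false, false))) := by
  rw [lintegral_prod _ hF.aemeasurable]
  refine lintegral_congr fun x => ?_
  have hx : Measurable fun w => F (x, w) := hF.comp measurable_prodMk_left
  rw [lintegral_prod _ hx.aemeasurable]
  simp [lintegral_count, tsum_fintype]

lemma integral_obsRef {F : (Fin d → ℝ) × Bool × Bool → ℝ} (hF : Integrable F (obsRef d)) :
    ∫ z, F z ∂(obsRef d) = ∫ x, ∫ w, F (x, w) ∂(Measure.count.prod Measure.count) :=
  integral_prod _ hF

lemma tendsto_integral_obsRef_mul_osc (i : Fin d) {ψ : (Fin d → ℝ) × Bool × Bool → ℝ}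
    (hψ : Integrable ψ (obsRef d)) :
    Tendsto (fun k => ∫ z, ψ z * osc i k z.1 ∂(obsRef d)) atTop (𝓝 0) := by
  refine (tendsto_integral_mul_osc i hψ.integral_prod_left).congr fun k => ?_
  have hm : Measurable fun z : (Fin d → ℝ) × Bool × Bool => osc i k z.1 :=
    (measurable_osc i k).comp measurable_fst
  rw [integral_obsRef (hψ.mul_bdd (c := 1) hm.aestronglyMeasurable
    (ae_of_all _ fun z => abs_osc_le_one i k z.1))]
  exact integral_congr_ae (ae_of_all _ fun x => (integral_mul_const _ _).symm)

end Observation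

namespace InCovClass

variable {d : ℕ} {muhat pihat : (Fin d → ℝ) → ℝ} {r s : ℝ} {q : CovParam d}

lemma pX_eq (h : InCovClass muhat pihat r s q) : q.pX = cubeDensity d := h.pX_uniform

lemma measurable_likelihood (h : InCovClass muhat pihat r s q) : Measurable q.likelihood := by
  have h1 := h.measurable_mu
  have h2 := h.measurable_pi
  have h3 := h.measurable_eta
  have h4 : Measurable q.pX := h.pX_eq ▸ measurable_cubeDensity
  refine measurable_from_prod_countable_left fun ⟨a, y⟩ => ?_
  cases a <;> cases y <;> simp only [CovParam.likelihood, CovParam.outcomeProb] <;>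
    simp <;> fun_prop

lemma likelihood_mem (h : InCovClass muhat pihat r s q) (z : (Fin d → ℝ) × Bool × Bool) :
    q.likelihood z ∈ Set.Icc 0 (cubeDensity d z.1) := by
  obtain ⟨x, a, y⟩ := z
  rw [CovParam.likelihood, h.pX_eq]
  by_cases hx : x ∈ cube d
  · have hp := h.pi_mem x hx
    have ho := h.outcomeProb_mem x hx a
    have hp' : (if a then q.pi x else 1 - q.pi x) ∈ Set.Icc (0 : ℝ) 1 := by
      cases a
      · simpa [and_comm] using hp
      · simpa using hp
    have ho' : (if y then q.outcomeProb x a else 1 - q.outcomeProb x a) ∈ Set.Icc (0 : ℝ) 1 := by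
      cases y
      · simpa [and_comm] using ho
      · simpa using ho
    simp only [cubeDensity_of_mem hx, one_mul]
    exact ⟨mul_nonneg hp'.1 ho'.1, mul_le_one₀ hp'.2 ho'.1 ho'.2⟩
  · simp [cubeDensity_of_notMem hx]

lemma integrable_likelihood (h : InCovClass muhat pihat r s q) :
    Integrable q.likelihood (obsRef d) := by
  refine Integrable.mono (g := fun z => cubeDensity d z.1) ?_
    h.measurable_likelihood.aestronglyMeasurable (ae_of_all _ fun z => ?_)
  · exact integrable_cubeDensity.comp_fst _
  · have := h.likelihood_mem z
    rw [Real.norm_of_nonneg this.1, Real.norm_of_nonneg (cubeDensity_nonneg _)]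
    exact this.2

lemma isProbabilityMeasure_law (h : InCovClass muhat pihat r s q) :
    IsProbabilityMeasure q.law := by
  refine ⟨?_⟩
  rw [CovParam.law, withDensity_apply _ MeasurableSet.univ, Measure.restrict_univ,
    lintegral_obsRef h.measurable_likelihood.ennreal_ofReal, ← lintegral_cubeDensity (d := d)]
  refine lintegral_congr fun x => ?_
  have h0 := fun w => (h.likelihood_mem (x, w)).1
  rw [← ENNReal.ofReal_add (h0 _) (h0 _), ← ENNReal.ofReal_add (h0 _) (h0 _),
    ← ENNReal.ofReal_add (add_nonneg (h0 _) (h0 _)) (add_nonneg (h0 _) (h0 _))]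
  congr 1
  simp only [CovParam.likelihood, h.pX_eq]
  simp
  ring

lemma isProbabilityMeasure_sampleLaw (h : InCovClass muhat pihat r s q) (n : ℕ) :
    IsProbabilityMeasure (CovParam.sampleLaw n q) := by
  have := h.isProbabilityMeasure_law
  unfold CovParam.sampleLaw
  infer_instance

lemma psi_eq (h : InCovClass muhat pihat r s q) :
    q.psi = (∫ x, q.likelihood (x, true, true)) - ∫ x, q.pi x * q.mu x * cubeDensity d x := by
  rw [CovParam.psi, h.pX_eq]
  congr 1
  rw [CovParam.law, integral_withDensity_eq_integral_toReal_smul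
    h.measurable_likelihood.ennreal_ofReal (ae_of_all _ fun z => ENNReal.ofReal_lt_top)]
  simp only [ENNReal.toReal_ofReal (h.likelihood_mem _).1, smul_eq_mul]
  rw [integral_obsRef]
  · refine integral_congr_ae (ae_of_all _ fun x => ?_)
    simp only
    rw [integral_prod]
    · simp [integral_fintype]
    · exact Integrable.of_finite
  · refine h.integrable_likelihood.mul_bdd (c := 1) ?_ (ae_of_all _ fun z => ?_)
    · exact (Measurable.aestronglyMeasurable (by
        refine measurable_from_prod_countable_left fun ⟨a, y⟩ => ?_
        exact measurable_const (a := (if a then 1 else 0) * (if y then 1 else 0))))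
    · obtain ⟨x, a, y⟩ := z
      cases a <;> cases y <;> simp

end InCovClass

/-! ### The product term: simultaneous oscillation of both regression functions. -/

section Radius

variable {d : ℕ} {ε a b r s : ℝ} {muhat pihat : (Fin d → ℝ) → ℝ}

/-- Both regression functions are tilted by `ρ`, while `E[A Y | X]` stays at `pihat * muhat`. -/
def covTilt (muhat pihat : (Fin d → ℝ) → ℝ) (a b : ℝ) (ρ : (Fin d → ℝ) → ℝ) : CovParam d where
  mu x := muhat x + a * ρ x
  pi x := pihat x + b * ρ x
  eta x := (pihat x * muhat x / (pihat x + b * ρ x) - (muhat x + a * ρ x)) /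
    (1 - (pihat x + b * ρ x))
  pX := cubeDensity d

/-- The coefficient of the tilt in the likelihood of a cell. -/
def cellSlope (a b : ℝ) (w : Bool × Bool) : ℝ :=
  if w.1 then (if w.2 then 0 else b) else (if w.2 then a else -(a + b))

/-- The cell probabilities under independence of `A` and `Y` given `X`. -/
def cellBase (m p : ℝ) (w : Bool × Bool) : ℝ :=
  (if w.1 then p else 1 - p) * (if w.2 then m else 1 - m)

/-- Each cell has probability at least `ε ^ 2` under independence, and the tilts move a cell by at
most `a + b ≤ ε ^ 2 / 2`. -/
lemma cell_bounds {m p t : ℝ} (hε : 0 < ε) (hm : m ∈ Set.Icc ε (1 - ε))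
    (hp : p ∈ Set.Icc ε (1 - ε)) (ha : a ∈ Set.Icc 0 (ε ^ 2 / 4)) (hb : b ∈ Set.Icc 0 (ε ^ 2 / 4))
    (ht : |t| ≤ 1) :
    0 < p + b * t ∧ 0 < 1 - (p + b * t) ∧ 0 ≤ p * m ∧ p * m ≤ p + b * t ∧ p * m ≤ m + a * t ∧
      m + a * t - p * m ≤ 1 - (p + b * t) := by
  obtain ⟨hm1, hm2⟩ := hm
  obtain ⟨hp1, hp2⟩ := hp
  obtain ⟨ha1, ha2⟩ := ha
  obtain ⟨hb1, hb2⟩ := hb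
  obtain ⟨ht1, ht2⟩ := abs_le.1 ht
  have e1 : a * t ≤ ε ^ 2 / 4 := by nlinarith
  have e2 : -(ε ^ 2 / 4) ≤ a * t := by nlinarith
  have e3 : b * t ≤ ε ^ 2 / 4 := by nlinarith
  have e4 : -(ε ^ 2 / 4) ≤ b * t := by nlinarith
  have hε1 : ε ≤ 1 / 2 := by linarith
  have q1 : ε ^ 2 ≤ p * (1 - m) := by rw [sq]; exact mul_le_mul hp1 (by linarith) hε.le (by linarith)
  have q2 : ε ^ 2 ≤ (1 - p) * m := by rw [sq]; exact mul_le_mul (by linarith) hm1 hε.le (by linarith)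
  have q3 : ε ^ 2 ≤ (1 - p) * (1 - m) := by
    rw [sq]; exact mul_le_mul (by linarith) (by linarith) hε.le (by linarith)
  have q4 : ε ^ 2 ≤ ε := by nlinarith
  have hpos : 0 < ε ^ 2 := by positivity
  refine ⟨by linarith, by linarith, mul_nonneg (by linarith) (by linarith), ?_, ?_, ?_⟩
  all_goals nlinarith

/-- With `P(A = 1, Y = 1 | X)` frozen, the other cells follow from the margins `π` and `μ` by
subtraction. No `ρ ^ 2` term appears, and such a term would survive Riemann–Lebesgue and reveal the
alternative. -/
lemma covTilt_likelihood (hε : 0 < ε) (hm : IsPilot ε muhat) (hp : IsPilot ε pihat)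
    (ha : a ∈ Set.Icc 0 (ε ^ 2 / 4)) (hb : b ∈ Set.Icc 0 (ε ^ 2 / 4)) {ρ : (Fin d → ℝ) → ℝ}
    (hρ : ∀ x, |ρ x| ≤ 1) (z : (Fin d → ℝ) × Bool × Bool) :
    (covTilt muhat pihat a b ρ).likelihood z =
      cubeDensity d z.1 * cellBase (muhat z.1) (pihat z.1) z.2 +
        cubeDensity d z.1 * cellSlope a b z.2 * ρ z.1 := by
  obtain ⟨x, α, y⟩ := z
  by_cases hx : x ∈ cube d
  · obtain ⟨h1, h2, -⟩ := cell_bounds hε (hm.mem x hx) (hp.mem x hx) ha hb (hρ x)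
    have h1' := h1.ne'
    have h2' := h2.ne'
    cases α <;> cases y <;>
      simp only [CovParam.likelihood, CovParam.outcomeProb, covTilt, cubeDensity_of_mem hx, cellBase,
        cellSlope, if_true, Bool.false_eq_true, if_false] <;> field_simp <;> ring
  · simp [CovParam.likelihood, covTilt, cubeDensity_of_notMem hx]

lemma covTilt_mem (hε : 0 < ε) (hm : IsPilot ε muhat) (hp : IsPilot ε pihat)
    (ha : a ∈ Set.Icc 0 (ε ^ 2 / 4)) (hb : b ∈ Set.Icc 0 (ε ^ 2 / 4)) (har : a ^ 2 ≤ r)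
    (hbs : b ^ 2 ≤ s) {ρ : (Fin d → ℝ) → ℝ} (hρm : Measurable ρ) (hρ : ∀ x, |ρ x| ≤ 1) :
    InCovClass muhat pihat r s (covTilt muhat pihat a b ρ) := by
  have mm := hm.measurable
  have mp := hp.measurable
  have close : ∀ c : ℝ, ∫ x, (c * ρ x) ^ 2 * cubeDensity d x ≤ c ^ 2 := fun c => by
    calc ∫ x, (c * ρ x) ^ 2 * cubeDensity d x ≤ ∫ x, c ^ 2 * cubeDensity d x := by
          refine integral_mono_of_nonneg
            (ae_of_all _ fun x => mul_nonneg (sq_nonneg _) (cubeDensity_nonneg x))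
            (integrable_cubeDensity.const_mul _) (ae_of_all _ fun x => ?_)
          refine mul_le_mul_of_nonneg_right ?_ (cubeDensity_nonneg x)
          rw [mul_pow]
          exact mul_le_of_le_one_right (sq_nonneg c) ((sq_le_one_iff_abs_le_one _).2 (hρ x))
      _ = c ^ 2 := by rw [integral_const_mul, integral_cubeDensity, mul_one]
  refine ⟨?_, ?_, ?_, rfl, fun x hx => ?_, fun x hx => ?_, fun x hx α => ?_, ?_, ?_⟩
  · exact mm.add (hρm.const_mul a)
  · exact mp.add (hρm.const_mul b)
  · exact (((mp.mul mm).div (mp.add (hρm.const_mul b))).sub (mm.add (hρm.const_mul a))).div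
      ((mp.add (hρm.const_mul b)).const_sub 1)
  · obtain ⟨h1, h2, h3, h4, h5, h6⟩ := cell_bounds hε (hm.mem x hx) (hp.mem x hx) ha hb (hρ x)
    exact ⟨by simp only [covTilt]; linarith, by simp only [covTilt]; linarith⟩
  · obtain ⟨h1, h2, h3, h4, h5, h6⟩ := cell_bounds hε (hm.mem x hx) (hp.mem x hx) ha hb (hρ x)
    exact ⟨by simp only [covTilt]; linarith, by simp only [covTilt]; linarith⟩
  · obtain ⟨h1, h2, h3, h4, h5, h6⟩ := cell_bounds hε (hm.mem x hx) (hp.mem x hx) ha hb (hρ x)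
    cases α
    · have e : (covTilt muhat pihat a b ρ).outcomeProb x false =
          (muhat x + a * ρ x - pihat x * muhat x) / (1 - (pihat x + b * ρ x)) := by
        simp only [CovParam.outcomeProb, covTilt, Bool.false_eq_true, if_false]
        have h1' := h1.ne'
        have h2' := h2.ne'
        generalize pihat x + b * ρ x = p at *
        field_simp
        ring
      rw [e]
      exact ⟨div_nonneg (by linarith) h2.le, (div_le_one h2).2 h6⟩
    · have e : (covTilt muhat pihat a b ρ).outcomeProb x true =
          pihat x * muhat x / (pihat x + b * ρ x) := by
        simp only [CovParam.outcomeProb, covTilt, if_true]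
        have h1' := h1.ne'
        have h2' := h2.ne'
        generalize pihat x + b * ρ x = p at *
        field_simp
        ring
      rw [e]
      exact ⟨div_nonneg h3 h1.le, (div_le_one h1).2 h4⟩
  · simp only [covTilt, add_sub_cancel_left]
    exact (close a).trans har
  · simp only [covTilt, add_sub_cancel_left]
    exact (close b).trans hbs

lemma IsPilot.abs_le_one {g : (Fin d → ℝ) → ℝ} (hε : 0 < ε) (hg : IsPilot ε g) {x : Fin d → ℝ}
    (hx : x ∈ cube d) : |g x| ≤ 1 := by
  have := hg.mem x hx
  rw [abs_le]
  constructor <;> linarith [this.1, this.2]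

lemma covMinimaxRisk_ge_radius (hε : 0 < ε) (hm : IsPilot ε muhat) (hp : IsPilot ε pihat)
    (hd : 1 ≤ d) (n : ℕ) (ha : a ∈ Set.Icc 0 (ε ^ 2 / 4)) (hb : b ∈ Set.Icc 0 (ε ^ 2 / 4))
    (har : a ^ 2 ≤ r) (hbs : b ^ 2 ≤ s) :
    ENNReal.ofReal ((-(a * b) / 2) ^ 2 / 64) ≤ covMinimaxRisk n muhat pihat r s := by
  set i : Fin d := ⟨0, hd⟩ with hi
  have m0 : InCovClass muhat pihat r s (covTilt muhat pihat a b 0) :=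
    covTilt_mem hε hm hp ha hb har hbs measurable_zero (by simp)
  have mk : ∀ k, InCovClass muhat pihat r s (covTilt muhat pihat a b (osc i k)) := fun k =>
    covTilt_mem hε hm hp ha hb har hbs (measurable_osc i k) (abs_osc_le_one i k)
  have := m0.isProbabilityMeasure_law
  have := fun k => (mk k).isProbabilityMeasure_law
  have := m0.isProbabilityMeasure_sampleLaw n
  have := fun k => (mk k).isProbabilityMeasure_sampleLaw n
  have l0 := covTilt_likelihood hε hm hp ha hb (ρ := 0) (by simp)
  have lk := fun k => covTilt_likelihood hε hm hp ha hb (abs_osc_le_one i k)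
  simp only [Pi.zero_apply, mul_zero, add_zero] at l0
  refine le_minimaxRisk_of_setwiseTendsto (θ₀ := covTilt muhat pihat a b 0)
    (θ := fun k => covTilt muhat pihat a b (osc i k)) m0 mk ?_ ?_
  · have iχ : Integrable (fun z => cubeDensity d z.1) (obsRef d) := integrable_cubeDensity.comp_fst _
    have hfin : IsFiniteMeasure
        ((obsRef d).withDensity fun z => ENNReal.ofReal (cubeDensity d z.1)) :=
      isFiniteMeasure_withDensity_ofReal iχ.2
    refine SetwiseTendsto.pi
      (η := (obsRef d).withDensity fun z => ENNReal.ofReal (cubeDensity d z.1)) (fun k => ?_) ?_ n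
    · exact withDensity_mono (ae_of_all _ fun z =>
        ENNReal.ofReal_le_ofReal ((mk k).likelihood_mem z).2)
    · have mw : Measurable fun z : (Fin d → ℝ) × Bool × Bool => cellSlope a b z.2 :=
        (measurable_of_countable (cellSlope a b)).comp measurable_snd
      have mv : Measurable fun z : (Fin d → ℝ) × Bool × Bool =>
          cubeDensity d z.1 * cellSlope a b z.2 :=
        (measurable_cubeDensity.comp measurable_fst).mul mw
      have hconv := setwiseTendsto_withDensity (m := obsRef d) (ρ := fun k z => osc i k z.1)
        (u := (covTilt muhat pihat a b 0).likelihood)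
        (v := fun z => cubeDensity d z.1 * cellSlope a b z.2)
        (fun k => (measurable_osc i k).comp measurable_fst) (fun k z => abs_osc_le_one i k z.1)
        (fun ψ hψ => tendsto_integral_obsRef_mul_osc i hψ) m0.measurable_likelihood mv
        m0.integrable_likelihood (iχ.mul_bdd (c := |a| + |b|)
          mw.aestronglyMeasurable (ae_of_all _ fun z => by
            obtain ⟨x, α, y⟩ := z
            have h1 := abs_nonneg a
            have h2 := abs_nonneg b
            cases α <;> cases y <;> simp [cellSlope]
            · rw [← abs_neg]
              simpa [add_comm] using abs_add_le a b
            · positivity))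
        (fun z => (m0.likelihood_mem z).1)
        (fun k z => by rw [l0, ← lk k]; exact ((mk k).likelihood_mem z).1)
      have e : ∀ k, (covTilt muhat pihat a b (osc i k)).law = (obsRef d).withDensity fun z =>
          ENNReal.ofReal ((covTilt muhat pihat a b 0).likelihood z +
            cubeDensity d z.1 * cellSlope a b z.2 * osc i k z.1) := fun k => by
        rw [CovParam.law]
        simp only [l0, lk]
      simp only [e]
      exact hconv
  -- The term `E[AY]` is the same for all alternatives, so `psi` moves only through `∫ πμ`, by `-(a
  -- * b) / 2` in the limit.
  · have e : ∀ k x, (covTilt muhat pihat a b (osc i k)).likelihood (x, true, true) =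
        (covTilt muhat pihat a b 0).likelihood (x, true, true) := fun k x => by
      rw [l0, lk]
      simp [cellSlope]
    simp only [fun k => (mk k).psi_eq, m0.psi_eq, e]
    have iuu : Integrable fun x => pihat x * (muhat x * cubeDensity d x) := by
      have := integrable_mul_cubeDensity (hp.measurable.mul hm.measurable) (C := 1) fun x hx => by
        rw [Pi.mul_apply, abs_mul]
        exact mul_le_one₀ (hp.abs_le_one hε hx) (abs_nonneg _) (hm.abs_le_one hε hx)
      simpa [mul_assoc] using this
    have iuv : Integrable fun x => pihat x * (a * cubeDensity d x) +
        b * (muhat x * cubeDensity d x) := by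
      refine Integrable.add ?_ (Integrable.const_mul (integrable_mul_cubeDensity hm.measurable
        fun x hx => hm.abs_le_one hε hx) b)
      have := (integrable_mul_cubeDensity hp.measurable
        fun x hx => hp.abs_le_one hε hx).const_mul a
      refine this.congr (ae_of_all _ fun x => ?_)
      simp only
      ring
    have ivv : Integrable fun x => b * (a * cubeDensity d x) :=
      (integrable_cubeDensity.const_mul a).const_mul b
    have h := tendsto_integral_mul_add_osc i (u₁ := pihat) (v₁ := fun _ => b)
      (u₂ := fun x => muhat x * cubeDensity d x) (v₂ := fun x => a * cubeDensity d x) iuu iuv ivv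
    have h2 := h.const_sub (∫ x, (covTilt muhat pihat a b 0).likelihood (x, true, true))
    convert h2 using 2
    · congr 1
      refine integral_congr_ae (ae_of_all _ fun x => ?_)
      simp only [covTilt]
      ring
    · rw [integral_const_mul, integral_const_mul, integral_cubeDensity]
      simp only [covTilt, Pi.zero_apply, mul_zero, add_zero, mul_assoc]
      ring

end Radius

/-! ### The parametric term `1 / n`: a constant effect at the pilot regressions. -/

section Parametric

variable {d : ℕ} {ε r s t : ℝ} {muhat pihat : (Fin d → ℝ) → ℝ}

/-- The law with the pilot regression functions and constant effect `t`. -/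
def covConst (muhat pihat : (Fin d → ℝ) → ℝ) (t : ℝ) : CovParam d where
  mu := muhat
  pi := pihat
  eta _ := t
  pX := cubeDensity d

lemma covConst_mem (hm : IsPilot ε muhat) (hp : IsPilot ε pihat) (hε : 0 < ε)
    (ht : t ∈ Set.Icc 0 ε) (hr : 0 ≤ r) (hs : 0 ≤ s) :
    InCovClass muhat pihat r s (covConst muhat pihat t) := by
  obtain ⟨ht1, ht2⟩ := ht
  refine ⟨hm.measurable, hp.measurable, measurable_const, rfl, fun x hx => ?_, fun x hx => ?_,
    fun x hx α => ?_, ?_, ?_⟩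
  · obtain ⟨h1, h2⟩ := hm.mem x hx
    exact ⟨by simp only [covConst]; linarith, by simp only [covConst]; linarith⟩
  · obtain ⟨h1, h2⟩ := hp.mem x hx
    exact ⟨by simp only [covConst]; linarith, by simp only [covConst]; linarith⟩
  · obtain ⟨h1, h2⟩ := hm.mem x hx
    obtain ⟨h3, h4⟩ := hp.mem x hx
    have h5 : pihat x * t ≤ ε := by nlinarith
    have h6 : 0 ≤ pihat x * t := mul_nonneg (by linarith) ht1
    cases α <;> simp only [CovParam.outcomeProb, covConst, if_true, Bool.false_eq_true, if_false] <;>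
      constructor <;> nlinarith
  · simpa [covConst] using hr
  · simpa [covConst] using hs

/-- The squared likelihood of `covConst muhat pihat t` over that of `covConst muhat pihat 0`. -/
def covConstRatio (muhat pihat : (Fin d → ℝ) → ℝ) (t : ℝ) (z : (Fin d → ℝ) × Bool × Bool) : ℝ :=
  cubeDensity d z.1 * (if z.2.1 then pihat z.1 else 1 - pihat z.1) *
    (if z.2.2 then (covConst muhat pihat t).outcomeProb z.1 z.2.1 ^ 2 / muhat z.1
      else (1 - (covConst muhat pihat t).outcomeProb z.1 z.2.1) ^ 2 / (1 - muhat z.1))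

lemma measurable_covConstRatio (hm : IsPilot ε muhat) (hp : IsPilot ε pihat) (t : ℝ) :
    Measurable (covConstRatio muhat pihat t) := by
  have h1 := hm.measurable
  have h2 := hp.measurable
  have h4 := measurable_cubeDensity (d := d)
  refine measurable_from_prod_countable_left fun ⟨a, y⟩ => ?_
  cases a <;> cases y <;> simp only [covConstRatio, CovParam.outcomeProb, covConst] <;>
    simp <;> fun_prop

lemma covConstRatio_nonneg (hm : IsPilot ε muhat) (hp : IsPilot ε pihat) (hε : 0 < ε)
    (z : (Fin d → ℝ) × Bool × Bool) : 0 ≤ covConstRatio muhat pihat t z := by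
  obtain ⟨x, α, y⟩ := z
  by_cases hx : x ∈ cube d
  · obtain ⟨h1, h2⟩ := hm.mem x hx
    obtain ⟨h3, h4⟩ := hp.mem x hx
    refine mul_nonneg (mul_nonneg (cubeDensity_nonneg x) ?_) ?_
    · cases α <;> simp <;> linarith
    · cases y
      · exact div_nonneg (sq_nonneg _) (by simp only; linarith)
      · exact div_nonneg (sq_nonneg _) (by simp only; linarith)
  · simp [covConstRatio, cubeDensity_of_notMem hx]

lemma covConst_likelihood_sq (hm : IsPilot ε muhat) (hε : 0 < ε)
    (z : (Fin d → ℝ) × Bool × Bool) :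
    (covConst muhat pihat t).likelihood z ^ 2 =
      (covConst muhat pihat 0).likelihood z * covConstRatio muhat pihat t z := by
  obtain ⟨x, α, y⟩ := z
  by_cases hx : x ∈ cube d
  · obtain ⟨h1, h2⟩ := hm.mem x hx
    have h5 : muhat x ≠ 0 := by linarith
    have h6 : 1 - muhat x ≠ 0 := by linarith
    have h0 : (covConst muhat pihat 0).outcomeProb x α = muhat x := by
      simp [CovParam.outcomeProb, covConst]
    rw [CovParam.likelihood, CovParam.likelihood, covConstRatio, h0]
    generalize (covConst muhat pihat t).outcomeProb x α = o
    simp only [covConst, cubeDensity_of_mem hx]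
    cases y <;> simp only [if_true, Bool.false_eq_true, if_false] <;> field_simp
  · simp [CovParam.likelihood, covConst, covConstRatio, cubeDensity_of_notMem hx]

lemma lintegral_covConstRatio_le (hm : IsPilot ε muhat) (hp : IsPilot ε pihat) (hε : 0 < ε) :
    ∫⁻ z, ENNReal.ofReal (covConstRatio muhat pihat t z) ∂(obsRef d) ≤
      ENNReal.ofReal (1 + t ^ 2 / ε ^ 2) := by
  rw [lintegral_obsRef (measurable_covConstRatio hm hp t).ennreal_ofReal]
  calc _ ≤ ∫⁻ x, ENNReal.ofReal (1 + t ^ 2 / ε ^ 2) * ENNReal.ofReal (cubeDensity d x) := by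
        refine lintegral_mono fun x => ?_
        have h0 := fun w => covConstRatio_nonneg (t := t) hm hp hε (x, w)
        rw [← ENNReal.ofReal_add (h0 _) (h0 _), ← ENNReal.ofReal_add (h0 _) (h0 _),
          ← ENNReal.ofReal_add (add_nonneg (h0 _) (h0 _)) (add_nonneg (h0 _) (h0 _)),
          ← ENNReal.ofReal_mul (by positivity)]
        refine ENNReal.ofReal_le_ofReal ?_
        by_cases hx : x ∈ cube d
        · obtain ⟨h1, h2⟩ := hm.mem x hx
          obtain ⟨h3, h4⟩ := hp.mem x hx
          simp only [covConstRatio, CovParam.outcomeProb, covConst, cubeDensity_of_mem hx, if_true,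
            Bool.false_eq_true, if_false, mul_one, one_mul]
          have hm0 : 0 < muhat x := by linarith
          have hm1 : 0 < 1 - muhat x := by linarith
          generalize muhat x = m at *
          generalize pihat x = p at *
          have hv : ε ^ 2 ≤ m * (1 - m) := by
            rw [sq]; exact mul_le_mul h1 (by linarith) hε.le hm0.le
          -- The terms linear in `t` cancel because the shifts `(1 - p) t` and `-p t` average to
          -- zero over `A`.
          have e : p * ((m + (1 - p) * t) ^ 2 / m) + p * ((1 - (m + (1 - p) * t)) ^ 2 / (1 - m)) +
              ((1 - p) * ((m - p * t) ^ 2 / m) + (1 - p) * ((1 - (m - p * t)) ^ 2 / (1 - m))) =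
              1 + p * (1 - p) * t ^ 2 / (m * (1 - m)) := by
            have := hm0.ne'
            have := hm1.ne'
            field_simp
            ring
          rw [e]
          gcongr
          have : p * (1 - p) ≤ 1 := by nlinarith
          exact mul_le_of_le_one_left (sq_nonneg t) this
        · simp [covConstRatio, cubeDensity_of_notMem hx]
    _ = ENNReal.ofReal (1 + t ^ 2 / ε ^ 2) := by
        rw [lintegral_const_mul _ measurable_cubeDensity.ennreal_ofReal, lintegral_cubeDensity,
          mul_one]

/-- The margins are those of the pilots for every `t`, so only `E[AY]` changes, by `t ∫ π(1 - π) ≥ ε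
^ 2 * t`. -/
lemma covConst_psi_sep (hm : IsPilot ε muhat) (hp : IsPilot ε pihat) (hε : 0 < ε)
    (ht : t ∈ Set.Icc 0 ε) :
    ε ^ 2 * t ≤ |(covConst muhat pihat t).psi - (covConst muhat pihat 0).psi| := by
  have m0 := covConst_mem (r := 0) (s := 0) hm hp hε (t := 0) ⟨le_rfl, hε.le⟩ le_rfl le_rfl
  have m1 := covConst_mem (r := 0) (s := 0) hm hp hε ht le_rfl le_rfl
  have hint : ∀ {q : CovParam d}, InCovClass muhat pihat 0 0 q →
      Integrable fun x => q.likelihood (x, true, true) := fun {q} hq => by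
    refine integrable_cubeDensity.mono
      (hq.measurable_likelihood.comp measurable_prodMk_right).aestronglyMeasurable
      (ae_of_all _ fun x => ?_)
    have := hq.likelihood_mem (x, true, true)
    rw [Real.norm_of_nonneg this.1, Real.norm_of_nonneg (cubeDensity_nonneg _)]
    exact this.2
  rw [m0.psi_eq, m1.psi_eq]
  change _ ≤ |_ - (∫ x, pihat x * muhat x * cubeDensity d x) -
    (_ - ∫ x, pihat x * muhat x * cubeDensity d x)|
  rw [sub_sub_sub_cancel_right, ← integral_sub (hint m1) (hint m0)]
  refine le_trans ?_ (le_abs_self _)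
  calc ε ^ 2 * t = ∫ x, ε ^ 2 * t * cubeDensity d x := by
        rw [integral_const_mul, integral_cubeDensity, mul_one]
    _ ≤ _ := by
        refine integral_mono (integrable_cubeDensity.const_mul _) ((hint m1).sub (hint m0))
          fun x => ?_
        simp only [CovParam.likelihood, CovParam.outcomeProb, covConst, if_true]
        by_cases hx : x ∈ cube d
        · obtain ⟨h3, h4⟩ := hp.mem x hx
          have hv : ε ^ 2 ≤ pihat x * (1 - pihat x) := by
            rw [sq]; exact mul_le_mul h3 (by linarith) hε.le (by linarith)
          rw [cubeDensity_of_mem hx]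
          linarith [mul_le_mul_of_nonneg_right hv ht.1]
        · simp [cubeDensity_of_notMem hx]

lemma covMinimaxRisk_ge_parametric (hm : IsPilot ε muhat) (hp : IsPilot ε pihat) (hε : 0 < ε)
    (ht : t ∈ Set.Icc 0 ε) (hr : 0 ≤ r) (hs : 0 ≤ s) {n : ℕ} (hn : n * (t ^ 2 / ε ^ 2) ≤ 1) :
    ENNReal.ofReal ((ε ^ 2 * t / 2) ^ 2 / 8) ≤ covMinimaxRisk n muhat pihat r s := by
  have m0 := covConst_mem (r := r) (s := s) hm hp hε (t := 0) ⟨le_rfl, hε.le⟩ hr hs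
  have m1 := covConst_mem (r := r) (s := s) hm hp hε ht hr hs
  have := m0.isProbabilityMeasure_law
  have := m1.isProbabilityMeasure_law
  have := m0.isProbabilityMeasure_sampleLaw n
  have := m1.isProbabilityMeasure_sampleLaw n
  refine le_minimaxRisk_of_chiSqLE (θ₀ := covConst muhat pihat 0) (θ₁ := covConst muhat pihat t)
    m0 m1 ?_ (by have := ht.1; positivity) ?_
  · refine (ChiSqLE.pi (B := ENNReal.ofReal (1 + t ^ 2 / ε ^ 2)) ?_ n).mono
      (one_add_pow_le_four (by positivity) hn)
    refine ChiSqLE.of_density (w := fun z => ENNReal.ofReal (covConstRatio muhat pihat t z))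
      m0.measurable_likelihood.ennreal_ofReal m1.measurable_likelihood.ennreal_ofReal
      (measurable_covConstRatio hm hp t).ennreal_ofReal (fun z => le_of_eq ?_)
      (lintegral_covConstRatio_le hm hp hε)
    rw [← ENNReal.ofReal_mul (m0.likelihood_mem z).1, ← ENNReal.ofReal_pow (m1.likelihood_mem z).1,
      covConst_likelihood_sq hm hε]
  · have := covConst_psi_sep hm hp hε ht
    linarith

end Parametric

theorem covMinimaxRisk_lower_bound {ε R : ℝ} (hε : 0 < ε) (hR : 0 < R) : ∃ c : ℝ, 0 < c ∧
    ∀ (d n : ℕ) (muhat pihat : (Fin d → ℝ) → ℝ) (r s : ℝ), 1 ≤ d → 1 ≤ n →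
      IsPilot ε muhat → IsPilot ε pihat → 0 ≤ r → r ≤ R → 0 ≤ s → s ≤ R →
      ENNReal.ofReal (c * (r * s + 1 / (n : ℝ))) ≤ covMinimaxRisk n muhat pihat r s := by
  set κ : ℝ := (ε ^ 2 / 4) ^ 2 with hκ
  have hκ0 : 0 < κ := by positivity
  set l : ℝ := min 1 (κ / R) with hl
  have hl0 : 0 < l := lt_min one_pos (by positivity)
  set c : ℝ := min (l ^ 2 / 256) (ε ^ 6 / 32) with hc
  have hc0 : 0 < c := lt_min (by positivity) (by positivity)
  refine ⟨c / 2, by positivity, fun d n muhat pihat r s hd hn hm hp hr hrR hs hsR => ?_⟩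
  have hn0 : (0 : ℝ) < n := by exact_mod_cast hn
  -- The amplitudes are capped at `ε ^ 2 / 4`, their squares at `κ`; for radii up to `R` the cap
  -- costs only the factor `l`.
  have hmin : ∀ {x : ℝ}, 0 ≤ x → x ≤ R → l * x ≤ min x κ := by
    intro x hx hxR
    refine le_min ?_ ?_
    · exact mul_le_of_le_one_left hx (min_le_left _ _)
    · calc l * x ≤ κ / R * R := by
            gcongr
            exact min_le_right _ _
        _ = κ := by field_simp
  have hsq : ∀ {x : ℝ}, 0 ≤ x → Real.sqrt (min x κ) ^ 2 = min x κ := fun hx =>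
    Real.sq_sqrt (le_min hx hκ0.le)
  have hmem : ∀ x : ℝ, Real.sqrt (min x κ) ∈ Set.Icc 0 (ε ^ 2 / 4) := fun x =>
    ⟨Real.sqrt_nonneg _, Real.sqrt_le_iff.2 ⟨by positivity, min_le_right _ _⟩⟩
  refine ofReal_mul_add_le_of_le ?_ ?_
  · rw [mul_div_cancel₀ _ two_ne_zero]
    refine (ENNReal.ofReal_le_ofReal ?_).trans (covMinimaxRisk_ge_radius hε hm hp hd n (hmem r)
      (hmem s) ((hsq hr).le.trans (min_le_left _ _)) ((hsq hs).le.trans (min_le_left _ _)))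
    have e : (-(Real.sqrt (min r κ) * Real.sqrt (min s κ)) / 2) ^ 2 / 64 =
        min r κ * min s κ / 256 := by
      rw [div_pow, neg_sq, mul_pow, hsq hr, hsq hs]
      ring
    rw [e]
    calc c * (r * s) ≤ l ^ 2 / 256 * (r * s) := by gcongr; exact min_le_left _ _
      _ = l * r * (l * s) / 256 := by ring
      _ ≤ min r κ * min s κ / 256 := by
          have h1 := hmin hr hrR
          have h2 := hmin hs hsR
          have : 0 ≤ l * s := by positivity
          gcongr
  · rw [mul_div_cancel₀ _ two_ne_zero]
    have hn1 : (1 : ℝ) ≤ n := by exact_mod_cast hn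
    have hsn : 1 ≤ Real.sqrt n := Real.one_le_sqrt.2 hn1
    have ht2 : (ε / Real.sqrt n) ^ 2 = ε ^ 2 / n := by rw [div_pow, Real.sq_sqrt hn0.le]
    -- The choice `t = ε / √n` makes `n * (t ^ 2 / ε ^ 2)` equal to 1, and `t ≤ ε` since `n ≥ 1`.
    refine (ENNReal.ofReal_le_ofReal ?_).trans (covMinimaxRisk_ge_parametric hm hp hε
      (t := ε / Real.sqrt n) ⟨by positivity, div_le_self hε.le hsn⟩ hr hs (n := n) ?_)
    · have e : (ε ^ 2 * (ε / Real.sqrt n) / 2) ^ 2 / 8 = ε ^ 6 / 32 * (1 / n) := by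
        rw [div_pow, mul_pow, ht2]
        ring
      rw [e]
      gcongr
      exact min_le_right _ _
    · rw [ht2]
      refine le_of_eq ?_
      field_simp

end StructureAgnostic

end

theorem theorem1 :
    -- Quadratic functional in the Gaussian sequence model.
    (∃ c : ℝ, 0 < c ∧
      ∀ (n : ℕ) (θhat : StructureAgnostic.SeqSpace) (r : ℝ), 1 ≤ n → 0 ≤ r →
        ENNReal.ofReal (c * (r ^ 2 + ‖θhat‖ ^ 2 * min r (1 / (n : ℝ)))) ≤
          StructureAgnostic.seqMinimaxRisk n θhat r) ∧
    -- Integral of the squared density.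
    (∀ M R : ℝ, 0 < M → 0 < R → ∃ c : ℝ, 0 < c ∧
      ∀ (d n : ℕ) (fhat : (Fin d → ℝ) → ℝ) (r : ℝ), 1 ≤ d → 1 ≤ n →
        StructureAgnostic.IsBoundedDensity M fhat → 0 ≤ r → r ≤ R →
        ENNReal.ofReal
            (c * (r ^ 2 + ((∫ x, fhat x ^ 3) - (∫ x, fhat x ^ 2) ^ 2) * min r (1 / (n : ℝ)))) ≤
          StructureAgnostic.densMinimaxRisk n M fhat r) ∧
    -- Expected conditional covariance.
    (∀ ε R : ℝ, 0 < ε → 0 < R → ∃ c : ℝ, 0 < c ∧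
      ∀ (d n : ℕ) (muhat pihat : (Fin d → ℝ) → ℝ) (r s : ℝ), 1 ≤ d → 1 ≤ n →
        StructureAgnostic.IsPilot ε muhat → StructureAgnostic.IsPilot ε pihat →
        0 ≤ r → r ≤ R → 0 ≤ s → s ≤ R →
        ENNReal.ofReal (c * (r * s + 1 / (n : ℝ))) ≤
          StructureAgnostic.covMinimaxRisk n muhat pihat r s) :=
  ⟨⟨1 / 128, by norm_num, fun _ θhat _ hn hr =>
      StructureAgnostic.seqMinimaxRisk_lower_bound hn θhat hr⟩,
    fun _ _ hM hR => StructureAgnostic.densMinimaxRisk_lower_bound hM hR,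
    fun _ _ hε hR => StructureAgnostic.covMinimaxRisk_lower_bound hε hR⟩
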